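/- Let $\mathbb A$ be an infinite set of atoms. A permutation of $\mathbb A$ acts on words, data vectors, sets, etc. by renaming atoms; a set is *orbit-finite* if, for some finite $T\subset\mathbb A$, it is a finite union of orbits under the permutations that fix $T$ pointwise. A *data vector* over an alphabet $\Gamma$ is a finitely supported function $\Gamma\to\mathbb N$; the *Parikh vector* of a word counts the occurrences of each letter, and the *Parikh image* of a language is the set of Parikh vectors of its words. *Rational* sets of data vectors form the least class that contains $\{\mathbf 0\}$ and $\{\sigma\}$ ($\sigma\in\Gamma$) and is closed under Minkowski sum, Kleene star (all finite sums of elements) and orbit-finite unions; the *star-height* is the least nesting depth of Kleene stars in a rational expression for the set, and a rational set of star-height at most one is *semi-linear*. For a finite set $H$ of labels, an *$r$-register $k$-block finite-memory automaton* over $H\times\mathbb A$ has finitely many states, an initial state, accepting states, a finite set $D\subset\mathbb A$ of constants, an initial assignment of pairwise distinct atoms to its $r$ registers, and finitely many rules $s\xrightarrow{h_1\cdots h_p,\,\varphi}s'$ with $0\le p\le k$, where $\varphi$ is a Boolean combination of equalities between the current register values, the $p$ input atoms, the next register values, and constants from $D$. Register contents are always pairwise distinct; a run on a word goes over a decomposition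 of the word into blocks read by rules. In an *$r$-register finite-memory automaton* each rule reads exactly one letter. For a finite set $S$, $k\ge 0$ and $p=k+1$, a *$k$-altering set* is a word $$\langle s_1,a_1,t_1\rangle\langle t_1,B_1,s_2\rangle\langle s_2,a_2,t_2\rangle\cdots\langle t_{n-1},B_{n-1},s_n\rangle\langle s_n,a_n,t_n\rangle,\qquad n\ge 1,$$ with $s_i,t_i\in S$, $a_i\in\mathbb A$, $B_i\subset\mathbb A$, $|B_i|=k$, $a_i\ne a_{i+1}$ and $B_i\cap\{a_i,a_{i+1}\}=\emptyset$. Its *ends* are $(s_1,a_1)$ and $(t_n,a_n)$. For $(t,s)\in S^2$ a word $w$ induces the set $A^{t,s}_w$ of the pairs $(a,B\cup\{c\})$ over all infixes $\langle\cdot,a,t\rangle\langle t,B,s\rangle\langle s,c,\cdot\rangle$ of $w$; for an altering set, these pairs lie in $\Theta_p$, where $\Theta_q=\{(a,B):a\in\mathbb A,\ B\subset\mathbb A,\ |B|=q,\ a\notin B\}$. *Controls.* A set $A$ of pairs $(a,B)$ is *$q$-unrestrained* if for every $(z,W)\in\Theta_q$ there is $(a,B)\in A$ with $a\notin W$ and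 $z\notin B$. For finite $X,Y\subset\mathbb A$, the pair $(X,Y)$ *controls* $A$ if every $(a,B)\in A$ has $a\in Y$ or $X\subseteq B$, and $A/(X,Y)=\{(a,B\setminus X):(a,B)\in A,\ a\notin Y\}$. A set $A\subseteq\Theta_p$ has *good control* $(X,Y)$ of a type if: (NULL) $A=\emptyset$; otherwise $A\neq\emptyset$, $(X,Y)$ controls $A$, and: (LC) $|X|=p$, $a\in Y$ for all $(a,B)\in A$, and each $y\in Y$ is the first component of some element of $A$; (RC) $|X|=p$ and $B=X$ for all $(a,B)\in A$; (FC) $|X|=p$, each $(a,B)\in A$ has $a\in Y$ or $B=X$, each $y\in Y$ is the first component of some element of $A$, and some $(a,X)\in A$; (URC) $|X|<p$, each $y\in Y$ is the first component of some element of $A$, and $A/(X,Y)$ is $(p-|X|)$-unrestrained. *Weak control* of $A$ means: $A=\emptyset$ for NULL; and for all $(a,B)\in A$: $a\in Y$ for LC; $B=X$ for RC; $a\in Y$ or $B=X$ for FC; $a\in Y$ or $X\subseteq B$ for URC. A *control profile* $\chi$ assigns to each $(t,s)\in S^2$ a type and sets $X^{t,s},Y^{t,s}\subset\mathbb A$ with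 $|X^{t,s}|\le p$ and $|Y^{t,s}|\le\binom{p+1}{2}$. $Q^\chi$ is the set of $k$-altering sets $w$ such that every $A^{t,s}_w$ has good control $(X^{t,s},Y^{t,s})$ of the type given by $\chi(t,s)$. $R^\chi$ is the set of words $\langle t,E,s\rangle\tau$ such that $|E|=k$, $\tau$ is a $k$-altering set with ends $(s,f)$ and $(t,d)$, $f\notin E$, $d\notin E\cup\{f\}$, the type at $(t,s)$ is not NULL, $\{(d,E\cup\{f\})\}$ has weak control of the type and sets given by $\chi(t,s)$, and each $A^{t',s'}_\tau$ has weak control of the type and sets given by $\chi(t',s')$. A subscript $N$ denotes restriction to words of length at most $N$. **Theorem.** 1. The Parikh image of the language of every one-register block finite-memory automaton (of any block size) is rational of star-height at most two. 2. For every finite non-empty label set $H$, the class of languages over $H\times\mathbb A$ of one-register block finite-memory automata strictly contains the class of languages of one-register finite-memory automata. 3. For every finite $S$ and every $k$, the set of all $k$-altering sets has a semi-linear Parikh image, and so does the set of all $k$-altering sets with any two prescribed ends. 4. For all $k$ and $m$ there are constants $N_0,N_1$ such that for every $S$ with $|S|=m$ and every control profile $\chi$, the Parikh image of $Q^\chi$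 is semi-linear and $$\mathrm{Par}(Q^\chi)=\mathrm{Par}(Q^\chi_{N_0})+\bigl(\mathrm{Par}(R^\chi_{N_1})\bigr)^{*}.$$ -/

import Mathlib

open scoped Pointwise

-- Data vectors `Γ →₀ ℕ` are renamed by renaming their letters.
attribute [local instance] Finsupp.comapSMul Finsupp.comapMulAction

namespace BlockParikh

/-! ### Orbit-finite sets, data vectors, rational sets -/

/-- `X` is a finite union of `T`-orbits for some finite set `T` of atoms, where the `T`-orbit of `x`
is its orbit under the permutations of the atoms that fix every element of `T`. -/
def OrbitFinite (Atom : Type*) {α : Type*} [MulAction (Equiv.Perm Atom) α] (X : Set α) : Prop :=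
  ∃ (T : Finset Atom) (R : Set α), R.Finite ∧
    X = ⋃ x ∈ R, MulAction.orbit (fixingSubgroup (Equiv.Perm Atom) (T : Set Atom)) x

/-- The set of all finite sums (including the empty one) of elements of `X`. -/
def kleeneStar {M : Type*} [AddCommMonoid M] (X : Set M) : Set M :=
  {v | ∃ l : List M, (∀ x ∈ l, x ∈ X) ∧ v = l.sum}

/-- `StarHeightLE Atom n X`: the set `X` of data vectors over the alphabet `Γ` is rational, and some
rational expression that defines it has Kleene stars nested at most `n` deep.
Orbit-finite unions are written `⋃₀ F` for an orbit-finite set `F` of sets of data vectors; the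
union of `f x` over the `x` in an orbit-finite `I`, for a finitely supported `f`, is `⋃₀ (f '' I)`,
and `f '' I` is again orbit-finite. -/
inductive StarHeightLE (Atom : Type*) {Γ : Type*} [MulAction (Equiv.Perm Atom) Γ] :
    ℕ → Set (Γ →₀ ℕ) → Prop
  | zero (n : ℕ) : StarHeightLE Atom n {0}
  | single (n : ℕ) (σ : Γ) : StarHeightLE Atom n {Finsupp.single σ 1}
  | add {n : ℕ} {X Y : Set (Γ →₀ ℕ)} :
      StarHeightLE Atom n X → StarHeightLE Atom n Y → StarHeightLE Atom n (X + Y)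
  | star {n : ℕ} {X : Set (Γ →₀ ℕ)} :
      StarHeightLE Atom n X → StarHeightLE Atom (n + 1) (kleeneStar X)
  | sUnion {n : ℕ} {F : Set (Set (Γ →₀ ℕ))} :
      OrbitFinite Atom F → (∀ X ∈ F, StarHeightLE Atom n X) → StarHeightLE Atom n (⋃₀ F)

/-- Semi-linear sets are the rational sets of star-height at most one. -/
def SemiLinear (Atom : Type*) {Γ : Type*} [MulAction (Equiv.Perm Atom) Γ]
    (X : Set (Γ →₀ ℕ)) : Prop :=
  StarHeightLE Atom 1 X

/-- The Parikh vector of a word: it counts the occurrences of each letter. -/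
noncomputable def parikh {Γ : Type*} (w : List Γ) : Γ →₀ ℕ :=
  (w.map fun σ => Finsupp.single σ 1).sum

/-- The Parikh image (commutative image) of a language. -/
def parikhImage {Γ : Type*} (L : Set (List Γ)) : Set (Γ →₀ ℕ) :=
  parikh '' L

/-! ### Finite-memory automata -/

/-- The input alphabet: pairs of a label and an atom. -/
structure Letter (H Atom : Type*) where
  label : H
  atom : Atom

instance (H Atom : Type*) : MulAction (Equiv.Perm Atom) (Letter H Atom) where
  smul π σ := ⟨σ.label, π σ.atom⟩
  one_smul _ := rfl
  mul_smul _ _ _ := rfl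

/-- The terms of a transition constraint that reads `p` letters with `r` registers: the current
register values, the input atoms, the next register values, and the constants from `D`. -/
inductive Term (Atom : Type*) (r p : ℕ) (D : Finset Atom)
  | cur (i : Fin r)
  | inp (j : Fin p)
  | next (i : Fin r)
  | const (d : D)

/-- The value of a term. -/
def Term.val {Atom : Type*} {r p : ℕ} {D : Finset Atom} (x : Fin r → Atom) (y : Fin p → Atom)
    (x' : Fin r → Atom) : Term Atom r p D → Atom
  | .cur i => x i
  | .inp j => y j
  | .next i => x' i
  | .const d => d

/-- Boolean combinations of equalities between terms. -/
inductive Constraint (T : Type*)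
  | top
  | eq (u v : T)
  | neg (φ : Constraint T)
  | and (φ ψ : Constraint T)
  | or (φ ψ : Constraint T)

/-- Satisfaction of a constraint under an evaluation of the terms. -/
def Constraint.Holds {T Atom : Type*} (ν : T → Atom) : Constraint T → Prop
  | .top => True
  | .eq u v => ν u = ν v
  | .neg φ => ¬ φ.Holds ν
  | .and φ ψ => φ.Holds ν ∧ ψ.Holds ν
  | .or φ ψ => φ.Holds ν ∨ ψ.Holds ν

/-- A configuration: a state and an assignment of pairwise distinct atoms to the registers. -/
abbrev Config (r : ℕ) (S Atom : Type*) := S × (Fin r ↪ Atom)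

/-- A transition rule of a finite-memory automaton; it reads one letter. -/
structure Rule (r : ℕ) (S H : Type*) {Atom : Type*} (D : Finset Atom) where
  src : S
  label : H
  guard : Constraint (Term Atom r 1 D)
  tgt : S

/-- An `r`-register finite-memory automaton with states `S` and labels `H`. -/
structure FMA (r : ℕ) (S H Atom : Type*) where
  init : S
  accept : Set S
  consts : Finset Atom
  reg₀ : Fin r ↪ Atom
  rules : Set (Rule r S H consts)
  rules_finite : rules.Finite

namespace FMA

variable {r : ℕ} {S H Atom : Type*}

/-- The transitions between configurations over a letter. -/
def Step (M : FMA r S H Atom) (c : Config r S Atom) (σ : Letter H Atom)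
    (c' : Config r S Atom) : Prop :=
  ∃ ρ ∈ M.rules, ρ.src = c.1 ∧ ρ.tgt = c'.1 ∧ ρ.label = σ.label ∧
    ρ.guard.Holds (Term.val c.2 (fun _ => σ.atom) c'.2)

/-- `M.Run c w c'`: there is a run on `w` from `c` to `c'`. -/
inductive Run (M : FMA r S H Atom) : Config r S Atom → List (Letter H Atom) → Config r S Atom → Prop
  | nil (c : Config r S Atom) : Run M c [] c
  | cons {c c' c'' : Config r S Atom} {σ : Letter H Atom} {w : List (Letter H Atom)} :
      M.Step c σ c' → Run M c' w c'' → Run M c (σ :: w) c''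

/-- The accepted words. -/
def language (M : FMA r S H Atom) : Set (List (Letter H Atom)) :=
  {w | ∃ s ∈ M.accept, ∃ a, M.Run (M.init, M.reg₀) w (s, a)}

end FMA

/-- A transition rule of a block finite-memory automaton; it reads `len` letters. -/
structure BlockRule (r : ℕ) (S H : Type*) {Atom : Type*} (D : Finset Atom) where
  src : S
  len : ℕ
  labels : Fin len → H
  guard : Constraint (Term Atom r len D)
  tgt : S

/-- An `r`-register `k`-block finite-memory automaton with states `S` and labels `H`. -/
structure BlockFMA (r k : ℕ) (S H Atom : Type*) where
  init : S
  accept : Set S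
  consts : Finset Atom
  reg₀ : Fin r ↪ Atom
  rules : Set (BlockRule r S H consts)
  rules_finite : rules.Finite
  len_le : ∀ ρ ∈ rules, ρ.len ≤ k

namespace BlockFMA

variable {r k : ℕ} {S H Atom : Type*}

/-- The transitions between configurations over a block of letters. -/
def Step (M : BlockFMA r k S H Atom) (c : Config r S Atom) (τ : List (Letter H Atom))
    (c' : Config r S Atom) : Prop :=
  ∃ ρ ∈ M.rules, ρ.src = c.1 ∧ ρ.tgt = c'.1 ∧ ∃ b : Fin ρ.len → Atom,
    ρ.guard.Holds (Term.val c.2 b c'.2) ∧ τ = List.ofFn fun i => ⟨ρ.labels i, b i⟩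

/-- `M.Run c w c'`: there is a run from `c` to `c'` over a decomposition of `w` into blocks. -/
inductive Run (M : BlockFMA r k S H Atom) :
    Config r S Atom → List (Letter H Atom) → Config r S Atom → Prop
  | nil (c : Config r S Atom) : Run M c [] c
  | cons {c c' c'' : Config r S Atom} {τ w : List (Letter H Atom)} :
      M.Step c τ c' → Run M c' w c'' → Run M c (τ ++ w) c''

/-- The accepted words. -/
def language (M : BlockFMA r k S H Atom) : Set (List (Letter H Atom)) :=
  {w | ∃ s ∈ M.accept, ∃ a, M.Run (M.init, M.reg₀) w (s, a)}

end BlockFMA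

/-- The languages over `H × Atom` of `r`-register finite-memory automata. -/
def fmaLanguages (r : ℕ) (H Atom : Type*) : Set (Set (List (Letter H Atom))) :=
  {L | ∃ (S : Type) (_ : Finite S) (M : FMA r S H Atom), L = M.language}

/-- The languages over `H × Atom` of `r`-register block finite-memory automata, of any block
size. -/
def blockFMALanguages (r : ℕ) (H Atom : Type*) : Set (Set (List (Letter H Atom))) :=
  {L | ∃ k : ℕ, 0 < k ∧ ∃ (S : Type) (_ : Finite S) (M : BlockFMA r k S H Atom), L = M.language}

/-! ### Altering sets -/

/-- The alphabet of the altering sets: triples `⟨s, a, t⟩` with an atom `a`, and triples `⟨s, B, t⟩`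
with a set `B` of `k` atoms. -/
inductive AltLetter (S Atom : Type*) (k : ℕ)
  | point (s : S) (a : Atom) (t : S)
  | block (s : S) (B : Finset Atom) (hB : B.card = k) (t : S)

/-- Renaming of the atoms in a letter. -/
def AltLetter.rename {S Atom : Type*} {k : ℕ} (π : Equiv.Perm Atom) :
    AltLetter S Atom k → AltLetter S Atom k
  | .point s a t => .point s (π a) t
  | .block s B hB t => .block s (B.map π.toEmbedding) ((Finset.card_map _).trans hB) t

instance (S Atom : Type*) (k : ℕ) : MulAction (Equiv.Perm Atom) (AltLetter S Atom k) where
  smul π σ := σ.rename π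
  one_smul σ := by
    cases σ with
    | point s a t => rfl
    | block s B hB t =>
      change AltLetter.block s (B.map (Equiv.refl Atom).toEmbedding) _ t = _
      congr 1
      ext a
      simp
  mul_smul π π' σ := by
    cases σ with
    | point s a t => rfl
    | block s B hB t =>
      change AltLetter.block s (B.map (π * π').toEmbedding) _ t =
        AltLetter.block s ((B.map π'.toEmbedding).map π.toEmbedding) _ t
      congr 1
      rw [Finset.map_map]
      rfl

/-- `Altering c w c'`: the word `w` is
`⟨s₁,a₁,t₁⟩⟨t₁,B₁,s₂⟩⟨s₂,a₂,t₂⟩⟨t₂,B₂,s₃⟩ ⋯ ⟨sₙ,aₙ,tₙ⟩` with `n ≥ 1`, where `aᵢ ≠ aᵢ₊₁` and `Bᵢ` is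
disjoint from `{aᵢ, aᵢ₊₁}` for all `i < n`, and `c = (s₁, a₁)`, `c' = (tₙ, aₙ)`. -/
inductive Altering {S Atom : Type*} {k : ℕ} : S × Atom → List (AltLetter S Atom k) → S × Atom → Prop
  | single (s : S) (a : Atom) (t : S) : Altering (s, a) [.point s a t] (t, a)
  | cons {s : S} {a : Atom} {t : S} {B : Finset Atom} {hB : B.card = k} {s' : S} {a' : Atom}
      {w : List (AltLetter S Atom k)} {c' : S × Atom} :
      a ≠ a' → a ∉ B → a' ∉ B → Altering (s', a') w c' →
      Altering (s, a) (.point s a t :: .block t B hB s' :: w) c'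

/-- The `k`-altering sets from `c` to `c'`. -/
def alteringBetween {S Atom : Type*} (k : ℕ) (c c' : S × Atom) : Set (List (AltLetter S Atom k)) :=
  {w | Altering c w c'}

/-- The language of all `k`-altering sets. -/
def alteringSets (S Atom : Type*) (k : ℕ) : Set (List (AltLetter S Atom k)) :=
  {w | ∃ c c', Altering c w c'}

/-! ### Controls -/

section Controls

open scoped Classical

variable {Atom : Type*}

/-- `A` is not restrained by any pair `(z, W)` with `W` a set of `p` atoms and `z ∉ W`. -/
def Unrestrained (p : ℕ) (A : Set (Atom × Finset Atom)) : Prop :=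
  ∀ (z : Atom) (W : Finset Atom), W.card = p → z ∉ W → ∃ θ ∈ A, θ.1 ∉ W ∧ z ∉ θ.2

/-- The pair `(X, Y)` controls `A`. -/
def Controls (X Y : Finset Atom) (A : Set (Atom × Finset Atom)) : Prop :=
  ∀ θ ∈ A, θ.1 ∈ Y ∨ X ⊆ θ.2

/-- The reduction `A / (X, Y)`. -/
noncomputable def reduction (A : Set (Atom × Finset Atom)) (X Y : Finset Atom) :
    Set (Atom × Finset Atom) :=
  {θ | ∃ B, (θ.1, B) ∈ A ∧ θ.1 ∉ Y ∧ θ.2 = B \ X}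

/-- The types of controls: none, left, right, full, unrestrained. -/
inductive ControlType
  | null
  | left
  | right
  | full
  | unrestrained

/-- `(X, Y)` is a good control of the given type of a set `A` of pairs `(a, B)` with `B` of size `p`
and `a ∉ B`; type `null` means that `A` is empty. -/
def GoodControl (p : ℕ) (X Y : Finset Atom) (A : Set (Atom × Finset Atom)) : ControlType → Prop
  | .null => A = ∅
  | .left => A.Nonempty ∧ Controls X Y A ∧ X.card = p ∧
      (∀ θ ∈ A, θ.1 ∈ Y) ∧ ∀ y ∈ Y, ∃ B, (y, B) ∈ A
  | .right => A.Nonempty ∧ Controls X Y A ∧ X.card = p ∧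
      (∀ θ ∈ A, θ.2 = X) ∧ ∃ a, (a, X) ∈ A
  | .full => A.Nonempty ∧ Controls X Y A ∧ X.card = p ∧
      (∀ θ ∈ A, θ.1 ∈ Y ∨ θ.2 = X) ∧ (∀ y ∈ Y, ∃ B, (y, B) ∈ A) ∧ ∃ a, (a, X) ∈ A
  | .unrestrained => A.Nonempty ∧ Controls X Y A ∧ X.card < p ∧
      (∀ y ∈ Y, ∃ B, (y, B) ∈ A) ∧ Unrestrained (p - X.card) (reduction A X Y)

/-- The condition for the insertion of the pair `θ` under a control `(X, Y)` of the given type. -/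
def InsertionCondition (X Y : Finset Atom) (θ : Atom × Finset Atom) : ControlType → Prop
  | .null => False
  | .left => θ.1 ∈ Y
  | .right => θ.2 = X
  | .full => θ.1 ∈ Y ∨ θ.2 = X
  | .unrestrained => θ.1 ∈ Y ∨ X ⊆ θ.2

/-- Weak good control of the given type; type `null` means that `A` is empty. -/
def WeakControl (X Y : Finset Atom) (A : Set (Atom × Finset Atom)) : ControlType → Prop
  | .null => A = ∅
  | .left => ∀ θ ∈ A, θ.1 ∈ Y
  | .right => ∀ θ ∈ A, θ.2 = X
  | .full => ∀ θ ∈ A, θ.1 ∈ Y ∨ θ.2 = X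
  | .unrestrained => Controls X Y A

/-- The set of the pairs `(aᵢ, Bᵢ ∪ {aᵢ₊₁})` over the infixes
`⟨sᵢ,aᵢ,t⟩⟨t,Bᵢ,s⟩⟨s,aᵢ₊₁,tᵢ₊₁⟩` of the word `w`. -/
noncomputable def inducedSet {S : Type*} {k : ℕ} (w : List (AltLetter S Atom k)) (t s : S) :
    Set (Atom × Finset Atom) :=
  {θ | ∃ (s' : S) (a : Atom) (B : Finset Atom) (hB : B.card = k) (c : Atom) (t' : S),
    [.point s' a t, .block t B hB s, .point s c t'] <:+: w ∧ θ = (a, insert c B)}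

/-- A control profile: a control type with a pair of finite sets of atoms for each pair of
states. -/
structure ControlProfile (S Atom : Type*) where
  type : S → S → ControlType
  X : S → S → Finset Atom
  Y : S → S → Finset Atom

/-- The size bounds on the sets of a control profile. -/
def ControlProfile.Bounded {S : Type*} (χ : ControlProfile S Atom) (p : ℕ) : Prop :=
  ∀ t s, (χ.X t s).card ≤ p ∧ (χ.Y t s).card ≤ (p + 1).choose 2

/-- The `k`-altering sets that are consistent with the control profile `χ`. -/
def profileLanguage {S : Type*} (k : ℕ) (χ : ControlProfile S Atom) :
    Set (List (AltLetter S Atom k)) :=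
  {w | w ∈ alteringSets S Atom k ∧
    ∀ t s, GoodControl (k + 1) (χ.X t s) (χ.Y t s) (inducedSet w t s) (χ.type t s)}

/-- The remainders `⟨t,E,s⟩ τ` compatible with the control profile `χ`: here `τ` is an altering set
from `(s, f)` to `(t, d)`. -/
def remainders {S : Type*} (k : ℕ) (χ : ControlProfile S Atom) :
    Set (List (AltLetter S Atom k)) :=
  {ρ | ∃ (t s : S) (E : Finset Atom) (hE : E.card = k) (f d : Atom) (τ : List (AltLetter S Atom k)),
    ρ = .block t E hE s :: τ ∧ Altering (s, f) τ (t, d) ∧ f ∉ E ∧ d ∉ insert f E ∧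
    InsertionCondition (χ.X t s) (χ.Y t s) (d, insert f E) (χ.type t s) ∧
    ∀ t' s', WeakControl (χ.X t' s') (χ.Y t' s') (inducedSet τ t' s') (χ.type t' s')}

end Controls

/-- The words of `L` of length at most `N`. -/
def boundedLength {Γ : Type*} (L : Set (List Γ)) (N : ℕ) : Set (List Γ) :=
  {w | w ∈ L ∧ w.length ≤ N}

end BlockParikh

/-!
The three results on Parikh images share one combinatorial core. An altering set is recorded by the
list of the data `((t, s), (a, B ∪ {b}))` of its infixes `⟨·,a,t⟩⟨t,B,s⟩⟨s,b,·⟩` (`Traced`), and a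
control profile restricts, for each `(t, s)`, the set of the pairs `(a, B ∪ {b})` that occur.

* Insertion (`exists_insert_remainder`). A remainder that is compatible with the profile can be
  inserted in every altering set that is consistent with it, and the result is again consistent.
  The delicate case is that of an unrestrained reduction, where the insertion splits an infix
  `(a, C)` into `(a, W)` and `(d, C)`: if some `(z, V)` restrained the new set, then `d ∈ V`, and
  the pair with `d` replaced by `a` in `V` would restrain the old one, unless `d` is already a first
  component (`GoodControl.exists_insertion`).
* Removal (`exists_decomposition`). Good control is witnessed by boundedly many infixes
  (`GoodControl.exists_finset`), so a long altering set has a long window free of witnesses. Among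
  many infixes of the window with the same states, two can exchange their first components, because
  every `C` contains boundedly many first components (`exists_exchange`); the part between the two
  is a remainder, and can be removed.

Together they give the decomposition for each profile (`parikhImage_profileWords`). Words of
bounded length have orbit-finite sets of Parikh vectors, so the profile language is semi-linear.
Every altering set is consistent with some profile of bounded size (`exists_goodControl`), and there
are orbit-finitely many such profiles, so the altering sets have a semi-linear Parikh image
(`semiLinear_altering`).

A run of a one-register block automaton is an altering set with substituted letters. Between two
changes of the register, the run is a walk in a finite graph, with orbit-finite sets attached to the
edges; such walks have a Parikh image of star-height one, by the special case of `0`-altering sets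
with two alternating atoms (`StarHeightLE.walk`). A step that changes the register from `a` to `a'`
reads letters with the atom `a`, which are charged to the point before the step, letters with the
atom `a'`, which are charged to the point after the step, and letters with at most `k` other atoms,
which form the block in between. Substitution adds up star-heights (`StarHeightLE.substitute`),
which yields star-height two. The words `abab` separate block automata from automata that read single
letters.

Orbit-finiteness is handled through codes of elements by tuples of atoms of bounded length (`Few`).
-/

namespace BlockParikh

/-! ### Finitely supported and orbit-finite sets -/

section OrbitFinite

variable {Atom : Type*} {α β : Type*}

/-- The permutation `π` fixes every atom of `T`. -/
def Fixes (T : Finset Atom) (π : Equiv.Perm Atom) : Prop := ∀ a ∈ T, π a = a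

theorem Fixes.mono {T T' : Finset Atom} (h : T ⊆ T') {π : Equiv.Perm Atom} (hπ : Fixes T' π) :
    Fixes T π := fun a ha => hπ a (h ha)

theorem Fixes.inv {T : Finset Atom} {π : Equiv.Perm Atom} (hπ : Fixes T π) : Fixes T π⁻¹ :=
  fun a ha => by rw [Equiv.Perm.inv_eq_iff_eq, hπ a ha]

/-- Two tuples of atoms with the same equalities among their entries and with the elements of `T`
are related by a permutation that fixes `T`. -/
theorem exists_perm {κ : Type*} [Finite κ] (T : Finset Atom) (c c' : κ → Atom)
    (h : ∀ i j, c i = c j ↔ c' i = c' j) (hT : ∀ i, ∀ t ∈ T, c i = t ↔ c' i = t) :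
    ∃ π : Equiv.Perm Atom, Fixes T π ∧ ∀ i, π (c i) = c' i := by
  let g : κ ⊕ T → Atom := Sum.elim c (fun t => t)
  let g' : κ ⊕ T → Atom := Sum.elim c' (fun t => t)
  have hg : ∀ x y, g x = g y ↔ g' x = g' y := by
    rintro (x | x) (y | y)
    · exact h x y
    · exact hT x y y.2
    · simpa only [g, g', Sum.elim_inl, Sum.elim_inr, eq_comm] using hT y x x.2
    · exact Iff.rfl
  obtain ⟨n, ⟨e⟩⟩ := Finite.exists_equiv_fin (Set.range g)
  have hr : ∀ x : Set.range g, g x.2.choose = x := fun x => x.2.choose_spec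
  let i₁ : Fin n ↪ Atom := ⟨fun i => e.symm i, fun i j hij => e.symm.injective (Subtype.ext hij)⟩
  let i₂ : Fin n ↪ Atom := ⟨fun i => g' (e.symm i).2.choose, fun i j hij => by
    have := (hg _ _).2 hij
    rw [hr, hr] at this
    exact e.symm.injective (Subtype.ext this)⟩
  obtain ⟨π, hπ⟩ := MulAction.isMultiplyPretransitive_iff.1
    (Equiv.Perm.isMultiplyPretransitive Atom n) i₁ i₂
  have key : ∀ x, π (g x) = g' x := by
    intro x
    have h₁ : π (e.symm (e ⟨g x, x, rfl⟩)).1 = g' (e.symm (e ⟨g x, x, rfl⟩)).2.choose :=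
      DFunLike.congr_fun hπ (e ⟨g x, x, rfl⟩)
    rw [e.symm_apply_apply] at h₁
    rw [h₁]
    exact (hg _ _).1 (hr ⟨g x, x, rfl⟩)
  exact ⟨π, fun a ha => key (Sum.inr ⟨a, ha⟩), fun i => key (Sum.inl i)⟩

variable [MulAction (Equiv.Perm Atom) α] [MulAction (Equiv.Perm Atom) β]

/-- The set `X` is invariant under the permutations that fix `T`. -/
def Supports (T : Finset Atom) (X : Set α) : Prop := ∀ π, Fixes T π → ∀ x ∈ X, π • x ∈ X

theorem Supports.mono {T T' : Finset Atom} (h : T ⊆ T') {X : Set α} (hX : Supports T X) :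
    Supports T' X := fun π hπ => hX π (hπ.mono h)

theorem Supports.smul_eq {T : Finset Atom} {X : Set α} (hX : Supports T X) {π : Equiv.Perm Atom}
    (hπ : Fixes T π) : π • X = X := by
  ext x
  rw [Set.mem_smul_set_iff_inv_smul_mem]
  refine ⟨fun h => ?_, fun h => hX _ hπ.inv _ h⟩
  simpa using hX _ hπ _ h

/-- The elements of `X` are coded by an index from a finite set and a tuple of atoms of bounded
length, in such a way that, up to permutations that fix `T`, the code determines the element. For
sets invariant under these permutations this is orbit-finiteness; unlike the latter, the notion
passes to subsets and products, and does not depend on the choice of `T`. -/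
def Few (T : Finset Atom) (X : Set α) : Prop :=
  ∃ (n N : ℕ) (i : α → Fin N) (c : α → Fin n → Atom), ∀ x ∈ X, ∀ y ∈ X, ∀ π, Fixes T π →
    i x = i y → (∀ j, c y j = π (c x j)) → y = π • x

theorem Few.mk {ι κ : Type*} [Finite ι] [Finite κ] {T : Finset Atom} {X : Set α} (i : α → ι)
    (c : α → κ → Atom) (h : ∀ x ∈ X, ∀ y ∈ X, ∀ π, Fixes T π →
      i x = i y → (∀ j, c y j = π (c x j)) → y = π • x) : Few T X := by
  obtain ⟨n, ⟨e⟩⟩ := Finite.exists_equiv_fin κ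
  obtain ⟨N, ⟨e'⟩⟩ := Finite.exists_equiv_fin ι
  refine ⟨n, N, fun x => e' (i x), fun x j => c x (e.symm j), fun x hx y hy π hπ hi hc => ?_⟩
  exact h x hx y hy π hπ (e'.injective hi) fun j => by simpa using hc (e j)

theorem Few.subset {T : Finset Atom} {X Y : Set α} (hY : Few T Y) (h : X ⊆ Y) : Few T X := by
  obtain ⟨n, N, i, c, H⟩ := hY
  exact ⟨n, N, i, c, fun x hx y hy => H x (h hx) y (h hy)⟩

theorem Few.mono {T T' : Finset Atom} (h : T ⊆ T') {X : Set α} (hX : Few T X) : Few T' X := by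
  obtain ⟨n, N, i, c, H⟩ := hX
  exact ⟨n, N, i, c, fun x hx y hy π hπ => H x hx y hy π (hπ.mono h)⟩

theorem Few.iUnion {ι : Type*} [Finite ι] {T : Finset Atom} {X : ι → Set α}
    (hX : ∀ a, Few T (X a)) : Few T (⋃ a, X a) := by
  choose n N i c H using hX
  refine Few.mk (ι := ∀ a, Prop × Fin (N a)) (κ := Σ a, Fin (n a))
    (fun x a => (x ∈ X a, i a x)) (fun x j => c j.1 x j.2) fun x hx y hy π hπ hi hc => ?_
  obtain ⟨a, ha⟩ := Set.mem_iUnion.1 hx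
  have h1 := congr_fun hi a
  simp only [Prod.mk.injEq, eq_iff_iff] at h1
  exact H a x ha y (h1.1.1 ha) π hπ h1.2 fun j => hc ⟨a, j⟩

theorem Few.union {T : Finset Atom} {X Y : Set α} (hX : Few T X) (hY : Few T Y) :
    Few T (X ∪ Y) := by
  rw [Set.union_eq_iUnion]
  exact .iUnion fun b => by cases b <;> assumption

theorem Few.prod {T : Finset Atom} {X : Set α} {Y : Set β} (hX : Few T X) (hY : Few T Y) :
    Few T (X ×ˢ Y) := by
  obtain ⟨n, N, i, c, H⟩ := hX
  obtain ⟨n', N', i', c', H'⟩ := hY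
  refine Few.mk (ι := Fin N × Fin N') (κ := Fin n ⊕ Fin n')
    (fun x => (i x.1, i' x.2)) (fun x => Sum.elim (c x.1) (c' x.2))
    fun x hx y hy π hπ hi hc => ?_
  simp only [Prod.mk.injEq] at hi
  exact Prod.ext (H _ hx.1 _ hy.1 π hπ hi.1 fun j => hc (Sum.inl j))
    (H' _ hx.2 _ hy.2 π hπ hi.2 fun j => hc (Sum.inr j))

theorem Few.image {T : Finset Atom} {X : Set α} (hX : Few T X) (f : α → β)
    (hf : ∀ π, Fixes T π → ∀ x, f (π • x) = π • f x) : Few T (f '' X) := by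
  classical
  obtain ⟨n, N, i, c, H⟩ := hX
  rcases X.eq_empty_or_nonempty with rfl | ⟨x₀, hx₀⟩
  · exact Few.mk (ι := Unit) (κ := Empty) (fun _ => ()) (fun _ => Empty.elim) (by simp)
  have : ∀ y : β, ∃ x, y ∈ f '' X → x ∈ X ∧ f x = y := fun y => by
    by_cases hy : y ∈ f '' X
    · obtain ⟨x, hx⟩ := hy
      exact ⟨x, fun _ => hx⟩
    · exact ⟨x₀, fun h => absurd h hy⟩
  choose s hs using this
  refine ⟨n, N, fun y => i (s y), fun y => c (s y), fun x hx y hy π hπ hi hc => ?_⟩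
  rw [← (hs y hy).2, H _ (hs x hx).1 _ (hs y hy).1 π hπ hi hc, hf π hπ, (hs x hx).2]

theorem Few.orbitFinite {T : Finset Atom} {X : Set α} (hX : Few T X) (hT : Supports T X) :
    OrbitFinite Atom X := by
  obtain ⟨n, N, i, c, H⟩ := hX
  let key : α → Fin N × (Fin n → Fin n → Prop) × (Fin n → T → Prop) := fun x =>
    (i x, fun j l => c x j = c x l, fun j t => c x j = t)
  obtain ⟨R, hRX, hR⟩ := (Set.surjOn_image key X).exists_bijOn_subset
  refine ⟨T, R, Set.Finite.of_finite_image (hR.image_eq ▸ Set.toFinite _) hR.injOn, ?_⟩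
  apply Set.Subset.antisymm
  · intro y hy
    obtain ⟨x, hx, hxy⟩ := hR.surjOn (Set.mem_image_of_mem key hy)
    simp only [key, Prod.mk.injEq, funext_iff, eq_iff_iff] at hxy
    obtain ⟨hi, h1, h2⟩ := hxy
    obtain ⟨π, hπ, hc⟩ := exists_perm T (c x) (c y) h1 fun j t ht => h2 j ⟨t, ht⟩
    refine Set.mem_biUnion hx ⟨⟨π, ?_⟩, ?_⟩
    · rw [mem_fixingSubgroup_iff]
      exact fun a ha => hπ a ha
    · exact (H x (hRX hx) y hy π hπ hi fun j => (hc j).symm).symm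
  · intro y hy
    obtain ⟨x, hx, ⟨π, hπ⟩, rfl⟩ := Set.mem_iUnion₂.1 hy
    rw [mem_fixingSubgroup_iff] at hπ
    exact hT π (fun a ha => hπ a ha) x (hRX hx)

/-- The orbit of a finitely supported element has few elements, whatever the supports. -/
theorem Few.orbit (T U V : Finset Atom) (x : α) (hx : ∀ π, Fixes V π → π • x = x) :
    Few U (MulAction.orbit (fixingSubgroup (Equiv.Perm Atom) (T : Set Atom)) x) := by
  classical
  have : ∀ y : α, ∃ π : Equiv.Perm Atom,
      y ∈ MulAction.orbit (fixingSubgroup (Equiv.Perm Atom) (T : Set Atom)) x → π • x = y := by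
    intro y
    by_cases hy : y ∈ MulAction.orbit (fixingSubgroup (Equiv.Perm Atom) (T : Set Atom)) x
    · obtain ⟨⟨π, _⟩, h⟩ := hy
      exact ⟨π, fun _ => h⟩
    · exact ⟨1, fun h => absurd h hy⟩
  choose s hs using this
  refine Few.mk (ι := Unit) (κ := V) (fun _ => ()) (fun y v => s y v) fun y hy z hz π _ _ hc => ?_
  have hfix : Fixes V ((π * s y)⁻¹ * s z) := fun v hv => by
    rw [Equiv.Perm.mul_apply, hc ⟨v, hv⟩, Equiv.Perm.inv_eq_iff_eq, Equiv.Perm.mul_apply]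
  have h := hx _ hfix
  rw [mul_smul, inv_smul_eq_iff, mul_smul, hs z hz, hs y hy] at h
  exact h

theorem OrbitFinite.few {X : Set α} (hX : OrbitFinite Atom X)
    (hsupp : ∀ x ∈ X, ∃ V : Finset Atom, ∀ π, Fixes V π → π • x = x) (U : Finset Atom) :
    Few U X := by
  obtain ⟨T, R, hR, rfl⟩ := hX
  have := hR.to_subtype
  rw [Set.biUnion_eq_iUnion]
  refine Few.iUnion fun x => ?_
  obtain ⟨V, hV⟩ := hsupp x (Set.mem_biUnion x.2 (MulAction.mem_orbit_self _))
  exact Few.orbit T U V _ hV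

theorem OrbitFinite.supports {X : Set α} (hX : OrbitFinite Atom X) :
    ∃ T : Finset Atom, Supports T X := by
  obtain ⟨T, R, -, rfl⟩ := hX
  refine ⟨T, fun π hπ y hy => ?_⟩
  obtain ⟨x, hx, hy⟩ := Set.mem_iUnion₂.1 hy
  refine Set.mem_biUnion hx ?_
  obtain ⟨⟨σ, hσ⟩, rfl⟩ := hy
  have : π ∈ fixingSubgroup (Equiv.Perm Atom) (T : Set Atom) := by
    rw [mem_fixingSubgroup_iff]
    exact fun a ha => hπ a ha
  exact ⟨⟨π * σ, mul_mem this hσ⟩, mul_smul π σ x⟩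

/-- An enumeration of the elements of a finite set of atoms, as a tuple of length `N`, determines
the set up to renaming. -/
theorem exists_finset_code [Nonempty Atom] (N : ℕ) : ∃ c : Finset Atom → Fin N → Atom,
    ∀ (B B' : Finset Atom) (π : Equiv.Perm Atom), B.card ≤ N → B.card = B'.card →
      (∀ j, c B' j = π (c B j)) → B' = B.map π.toEmbedding := by
  obtain ⟨a₀⟩ := ‹Nonempty Atom›
  refine ⟨fun B j => B.toList.getD j a₀, fun B B' π hN hB hc => ?_⟩
  have : B'.toList = B.toList.map π := by
    apply List.ext_getElem
    · simp [hB]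
    · intro i h1 h2
      have hi : i < B.toList.length := by simpa using h2
      have := hc ⟨i, by simp only [Finset.length_toList] at hi; omega⟩
      simpa only [List.getD_eq_getElem _ _ h1, List.getD_eq_getElem _ _ hi,
        List.getElem_map] using this
  ext a
  rw [← Finset.mem_toList, this, Finset.mem_map, List.mem_map]
  simp only [Finset.mem_toList, Equiv.coe_toEmbedding]

end OrbitFinite

/-! ### Rational sets of data vectors -/

section StarHeight

variable {Atom : Type*} {Γ Γ' : Type*} [MulAction (Equiv.Perm Atom) Γ]
  [MulAction (Equiv.Perm Atom) Γ']

/-- An alphabet with finitely many orbits of letters, all of them finitely supported. -/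
class OrbitFiniteAlphabet (Atom Γ : Type*) [MulAction (Equiv.Perm Atom) Γ] : Prop where
  few : Few (∅ : Finset Atom) (Set.univ : Set Γ)
  supported : ∀ σ : Γ, ∃ V : Finset Atom, ∀ π : Equiv.Perm Atom, Fixes V π → π • σ = σ

theorem smul_vec_add (π : Equiv.Perm Atom) (v w : Γ →₀ ℕ) : π • (v + w) = π • v + π • w :=
  Finsupp.mapDomain_add

theorem smul_vec_zero (π : Equiv.Perm Atom) : π • (0 : Γ →₀ ℕ) = 0 :=
  Finsupp.mapDomain_zero

theorem parikh_nil : parikh ([] : List Γ) = 0 := rfl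

theorem parikh_cons (σ : Γ) (w : List Γ) : parikh (σ :: w) = Finsupp.single σ 1 + parikh w := by
  simp [parikh]

theorem parikh_append (w w' : List Γ) : parikh (w ++ w') = parikh w + parikh w' := by
  simp [parikh]

theorem smul_parikh (π : Equiv.Perm Atom) (w : List Γ) :
    π • parikh w = parikh (w.map (π • ·)) := by
  induction w with
  | nil => exact smul_vec_zero π
  | cons σ w ih =>
    rw [List.map_cons, parikh_cons, parikh_cons, smul_vec_add, ih, Finsupp.comapSMul_single]

/-- Equivariance, under the permutations that fix `T`, of a map whose values are sets. -/
def SetEquivariant {β γ : Type*} [MulAction (Equiv.Perm Atom) β] [MulAction (Equiv.Perm Atom) γ]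
    (T : Finset Atom) (f : β → Set γ) : Prop :=
  ∀ π, Fixes T π → ∀ x, ∀ v ∈ f x, π • v ∈ f (π • x)

theorem SetEquivariant.map_smul {β γ : Type*} [MulAction (Equiv.Perm Atom) β]
    [MulAction (Equiv.Perm Atom) γ] {T : Finset Atom} {f : β → Set γ} (hf : SetEquivariant T f)
    {π : Equiv.Perm Atom} (hπ : Fixes T π) (x : β) : f (π • x) = π • f x := by
  ext v
  rw [Set.mem_smul_set_iff_inv_smul_mem]
  constructor
  · intro h
    simpa using hf _ hπ.inv _ _ h
  · intro h
    simpa using hf _ hπ _ _ h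

theorem smul_set_add (π : Equiv.Perm Atom) (X Y : Set (Γ →₀ ℕ)) :
    π • (X + Y) = π • X + π • Y := by
  ext v
  simp only [Set.mem_smul_set, Set.mem_add]
  constructor
  · rintro ⟨_, ⟨x, hx, y, hy, rfl⟩, rfl⟩
    exact ⟨_, ⟨x, hx, rfl⟩, _, ⟨y, hy, rfl⟩, (smul_vec_add π x y).symm⟩
  · rintro ⟨_, ⟨x, hx, rfl⟩, _, ⟨y, hy, rfl⟩, rfl⟩
    exact ⟨_, ⟨x, hx, y, hy, rfl⟩, smul_vec_add π x y⟩

theorem StarHeightLE.mono {n m : ℕ} {X : Set (Γ →₀ ℕ)} (h : StarHeightLE Atom n X) (hnm : n ≤ m) :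
    StarHeightLE Atom m X := by
  induction h generalizing m with
  | zero n => exact .zero m
  | single n σ => exact .single m σ
  | add _ _ ih ih' => exact .add (ih hnm) (ih' hnm)
  | star _ ih =>
    obtain ⟨m, rfl⟩ := Nat.exists_eq_add_of_le' (Nat.one_le_of_lt hnm)
    exact .star (ih (by omega))
  | sUnion hF _ ih => exact .sUnion hF fun X hX => ih X hX hnm

theorem StarHeightLE.empty (n : ℕ) : StarHeightLE Atom n (∅ : Set (Γ →₀ ℕ)) := by
  rw [← Set.sUnion_empty]
  exact .sUnion ⟨∅, ∅, Set.finite_empty, by simp⟩ (by simp)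

theorem StarHeightLE.singleton (n : ℕ) (v : Γ →₀ ℕ) : StarHeightLE Atom n {v} := by
  induction v using Finsupp.induction_linear with
  | zero => exact .zero n
  | add v w hv hw =>
    rw [← Set.singleton_add_singleton]
    exact .add hv hw
  | single σ c =>
    induction c with
    | zero =>
      rw [Finsupp.single_zero]
      exact .zero n
    | succ c ih =>
      rw [Finsupp.single_add, ← Set.singleton_add_singleton]
      exact .add ih (.single n σ)

theorem kleeneStar_smul_mem {π : Equiv.Perm Atom} {X Y : Set (Γ →₀ ℕ)}
    (h : ∀ x ∈ X, π • x ∈ Y) {v : Γ →₀ ℕ} (hv : v ∈ kleeneStar X) : π • v ∈ kleeneStar Y := by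
  obtain ⟨l, hl, rfl⟩ := hv
  induction l with
  | nil => exact ⟨[], by simp, smul_vec_zero π⟩
  | cons x l ih =>
    obtain ⟨l', hl', h'⟩ := ih fun y hy => hl y (List.mem_cons_of_mem _ hy)
    refine ⟨π • x :: l', ?_, ?_⟩
    · simpa [h x (hl x List.mem_cons_self)] using hl'
    · rw [List.sum_cons, smul_vec_add, h', List.sum_cons]

theorem StarHeightLE.supported [OrbitFiniteAlphabet Atom Γ] {n : ℕ} {X : Set (Γ →₀ ℕ)}
    (h : StarHeightLE Atom n X) : ∃ T : Finset Atom, Supports T X := by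
  classical
  induction h with
  | zero n =>
    refine ⟨∅, fun π _ x hx => ?_⟩
    rw [Set.mem_singleton_iff.1 hx, smul_vec_zero]
    rfl
  | single n σ =>
    obtain ⟨V, hV⟩ := OrbitFiniteAlphabet.supported (Atom := Atom) σ
    refine ⟨V, fun π hπ x hx => ?_⟩
    rw [Set.mem_singleton_iff.1 hx, Finsupp.comapSMul_single, hV π hπ]
    rfl
  | add _ _ ih ih' =>
    obtain ⟨T, hT⟩ := ih
    obtain ⟨T', hT'⟩ := ih'
    refine ⟨T ∪ T', fun π hπ v hv => ?_⟩
    obtain ⟨x, hx, y, hy, rfl⟩ := Set.mem_add.1 hv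
    rw [smul_vec_add]
    exact Set.add_mem_add (hT π (hπ.mono Finset.subset_union_left) x hx)
      (hT' π (hπ.mono Finset.subset_union_right) y hy)
  | star _ ih =>
    obtain ⟨T, hT⟩ := ih
    exact ⟨T, fun π hπ v hv => kleeneStar_smul_mem (hT π hπ) hv⟩
  | sUnion hF _ _ =>
    obtain ⟨T, hT⟩ := hF.supports
    refine ⟨T, fun π hπ v hv => ?_⟩
    obtain ⟨X, hX, hv⟩ := hv
    exact ⟨π • X, hT π hπ X hX, Set.smul_mem_smul_set hv⟩

theorem StarHeightLE.iUnion [OrbitFiniteAlphabet Atom Γ] {n : ℕ} {ι : Type*} [Finite ι]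
    {X : ι → Set (Γ →₀ ℕ)} (h : ∀ i, StarHeightLE Atom n (X i)) :
    StarHeightLE Atom n (⋃ i, X i) := by
  classical
  choose T hT using fun i => (h i).supported
  have := Fintype.ofFinite ι
  rw [← Set.sUnion_range]
  refine .sUnion ⟨Finset.univ.biUnion T, Set.range X, Set.finite_range X, ?_⟩ ?_
  · apply Set.Subset.antisymm
    · exact fun Y hY => Set.mem_biUnion hY (MulAction.mem_orbit_self _)
    · intro Y hY
      obtain ⟨_, ⟨i, rfl⟩, ⟨π, hπ⟩, rfl⟩ := Set.mem_iUnion₂.1 hY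
      rw [mem_fixingSubgroup_iff] at hπ
      refine ⟨i, ((hT i).smul_eq (π := π) fun a ha => hπ a ?_).symm⟩
      exact Finset.mem_biUnion.2 ⟨i, Finset.mem_univ i, ha⟩
  · rintro _ ⟨i, rfl⟩
    exact h i

theorem StarHeightLE.union [OrbitFiniteAlphabet Atom Γ] {n : ℕ} {X Y : Set (Γ →₀ ℕ)}
    (hX : StarHeightLE Atom n X) (hY : StarHeightLE Atom n Y) : StarHeightLE Atom n (X ∪ Y) := by
  rw [Set.union_eq_iUnion]
  exact .iUnion fun b => by cases b <;> assumption

/-- Orbit-finite unions indexed by a set on which the permutations act. -/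
theorem StarHeightLE.biUnion {β : Type*} [MulAction (Equiv.Perm Atom) β] {n : ℕ} {I : Set β}
    {T : Finset Atom} (hI : Few T I) (hT : Supports T I) {f : β → Set (Γ →₀ ℕ)}
    (hf : SetEquivariant T f) (h : ∀ x ∈ I, StarHeightLE Atom n (f x)) :
    StarHeightLE Atom n (⋃ x ∈ I, f x) := by
  rw [← Set.sUnion_image]
  refine .sUnion ((hI.image f fun π hπ x => hf.map_smul hπ x).orbitFinite (T := T) ?_) ?_
  · rintro π hπ _ ⟨x, hx, rfl⟩
    exact ⟨π • x, hT π hπ x hx, hf.map_smul hπ x⟩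
  · rintro _ ⟨x, hx, rfl⟩
    exact h x hx

theorem few_parikh [OrbitFiniteAlphabet Atom Γ] (N : ℕ) :
    Few (∅ : Finset Atom) {v : Γ →₀ ℕ | ∃ w : List Γ, w.length ≤ N ∧ v = parikh w} := by
  induction N with
  | zero =>
    refine Few.mk (ι := Unit) (κ := Empty) (fun _ => ()) (fun _ => Empty.elim) ?_
    rintro x ⟨w, hw, rfl⟩ y ⟨w', hw', rfl⟩ π - - -
    rw [List.length_eq_zero_iff.1 (Nat.le_zero.1 hw), List.length_eq_zero_iff.1 (Nat.le_zero.1 hw')]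
    exact (smul_vec_zero π).symm
  | succ N ih =>
    have h := (OrbitFiniteAlphabet.few (Atom := Atom) (Γ := Γ)).prod ih
    have h := h.image (fun p => Finsupp.single p.1 1 + p.2) fun π _ p => by
      change Finsupp.single (π • p.1) 1 + π • p.2 = _
      rw [smul_vec_add, Finsupp.comapSMul_single]
    refine (ih.union h).subset ?_
    rintro _ ⟨w, hw, rfl⟩
    rcases w with _ | ⟨σ, w⟩
    · exact Or.inl ⟨[], Nat.zero_le _, rfl⟩
    · exact Or.inr ⟨(σ, parikh w), ⟨Set.mem_univ _, w, by simpa using hw, rfl⟩,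
        (parikh_cons σ w).symm⟩

/-- A finitely supported set of data vectors of bounded size is rational of star-height zero. -/
theorem StarHeightLE.of_bounded [OrbitFiniteAlphabet Atom Γ] {X : Set (Γ →₀ ℕ)} {T : Finset Atom}
    (hT : Supports T X) (N : ℕ) (hN : ∀ v ∈ X, ∃ w : List Γ, w.length ≤ N ∧ v = parikh w) (n : ℕ) :
    StarHeightLE Atom n X := by
  rw [← Set.biUnion_of_singleton X]
  refine .biUnion (((few_parikh N).mono (Finset.empty_subset T)).subset hN) hT ?_
    fun v _ => .singleton n v
  rintro π - v w hw
  rw [Set.mem_singleton_iff.1 hw]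
  rfl

/-- The substitution, in a set of data vectors, of a set of data vectors for each letter; distinct
occurrences of a letter are replaced independently. -/
noncomputable def substitute (f : Γ → Set (Γ' →₀ ℕ)) (X : Set (Γ →₀ ℕ)) : Set (Γ' →₀ ℕ) :=
  ⋃ v ∈ X, ((Finsupp.toMultiset v).map f).sum

theorem toMultiset_parikh (w : List Γ) : Finsupp.toMultiset (parikh w) = w := by
  induction w with
  | nil => rfl
  | cons σ w ih =>
    rw [parikh_cons, map_add, ih, Finsupp.toMultiset_single, one_smul]
    rfl

theorem substitute_parikhImage (f : Γ → Set (Γ' →₀ ℕ)) (L : Set (List Γ)) :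
    substitute f (parikhImage L) = ⋃ w ∈ L, (w.map f).sum := by
  simp only [substitute, parikhImage, Set.biUnion_image, toMultiset_parikh, Multiset.map_coe,
    Multiset.sum_coe]

theorem substitute_add (f : Γ → Set (Γ' →₀ ℕ)) (X Y : Set (Γ →₀ ℕ)) :
    substitute f (X + Y) = substitute f X + substitute f Y := by
  ext u
  simp only [substitute, Set.mem_iUnion₂, Set.mem_add]
  constructor
  · rintro ⟨_, ⟨x, hx, y, hy, rfl⟩, hu⟩
    rw [map_add, Multiset.map_add, Multiset.sum_add, Set.mem_add] at hu
    obtain ⟨a, ha, b, hb, rfl⟩ := hu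
    exact ⟨a, ⟨x, hx, ha⟩, b, ⟨y, hy, hb⟩, rfl⟩
  · rintro ⟨a, ⟨x, hx, ha⟩, b, ⟨y, hy, hb⟩, rfl⟩
    refine ⟨x + y, ⟨x, hx, y, hy, rfl⟩, ?_⟩
    rw [map_add, Multiset.map_add, Multiset.sum_add]
    exact Set.add_mem_add ha hb

theorem substitute_zero (f : Γ → Set (Γ' →₀ ℕ)) : substitute f {0} = {0} := by
  simp only [substitute, Set.biUnion_singleton, map_zero, Multiset.map_zero, Multiset.sum_zero]
  rfl

theorem mem_kleeneStar_cons {M : Type*} [AddCommMonoid M] {X : Set M} {x y : M} (hx : x ∈ X)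
    (hy : y ∈ kleeneStar X) : x + y ∈ kleeneStar X := by
  obtain ⟨l, hl, rfl⟩ := hy
  exact ⟨x :: l, by simpa [hx] using hl, by simp⟩

theorem substitute_kleeneStar (f : Γ → Set (Γ' →₀ ℕ)) (X : Set (Γ →₀ ℕ)) :
    substitute f (kleeneStar X) = kleeneStar (substitute f X) := by
  apply Set.Subset.antisymm
  · intro u hu'
    obtain ⟨v, ⟨l, hl, hv⟩, hu⟩ := Set.mem_iUnion₂.1 hu'
    subst hv
    clear hu'
    induction l generalizing u with
    | nil =>
      rw [List.sum_nil, map_zero, Multiset.map_zero, Multiset.sum_zero] at hu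
      exact ⟨[], by simp, hu⟩
    | cons x l ih =>
      rw [List.sum_cons, map_add, Multiset.map_add, Multiset.sum_add, Set.mem_add] at hu
      obtain ⟨a, ha, b, hb, rfl⟩ := hu
      exact mem_kleeneStar_cons (Set.mem_biUnion (hl x List.mem_cons_self) ha)
        (ih (fun y hy => hl y (List.mem_cons_of_mem _ hy)) hb)
  · rintro _ ⟨l, hl, rfl⟩
    induction l with
    | nil => exact Set.mem_biUnion (x := 0) ⟨[], by simp, rfl⟩ rfl
    | cons a l ih =>
      obtain ⟨y, hy, hb⟩ := Set.mem_iUnion₂.1 (ih fun b hb => hl b (List.mem_cons_of_mem _ hb))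
      obtain ⟨x, hx, ha⟩ := Set.mem_iUnion₂.1 (hl a List.mem_cons_self)
      refine Set.mem_biUnion (mem_kleeneStar_cons hx hy) ?_
      rw [List.sum_cons, map_add, Multiset.map_add, Multiset.sum_add]
      exact Set.add_mem_add ha hb

theorem sum_map_smul {T : Finset Atom} {f : Γ → Set (Γ' →₀ ℕ)} (hf : SetEquivariant T f)
    {π : Equiv.Perm Atom} (hπ : Fixes T π) (w : Multiset Γ) :
    ((w.map (π • ·)).map f).sum = π • (w.map f).sum := by
  induction w using Multiset.induction with
  | empty =>
    change ({0} : Set (Γ' →₀ ℕ)) = π • {0}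
    rw [Set.smul_set_singleton, smul_vec_zero]
  | cons σ w ih =>
    rw [Multiset.map_cons, Multiset.map_cons, Multiset.sum_cons, Multiset.map_cons,
      Multiset.sum_cons, ih, hf.map_smul hπ, smul_set_add]

theorem substitute_smul {T : Finset Atom} {f : Γ → Set (Γ' →₀ ℕ)} (hf : SetEquivariant T f)
    {π : Equiv.Perm Atom} (hπ : Fixes T π) (X : Set (Γ →₀ ℕ)) :
    substitute f (π • X) = π • substitute f X := by
  have key (v : Γ →₀ ℕ) : ((Finsupp.toMultiset (π • v)).map f).sum =
      π • ((Finsupp.toMultiset v).map f).sum := by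
    rw [← sum_map_smul hf hπ, Finsupp.comapSMul_def, ← Finsupp.toMultiset_map]
  ext u
  simp only [substitute, Set.mem_iUnion₂, Set.mem_smul_set_iff_inv_smul_mem, exists_prop]
  constructor
  · rintro ⟨v, hv, hu⟩
    refine ⟨π⁻¹ • v, hv, ?_⟩
    rwa [← Set.mem_smul_set_iff_inv_smul_mem, ← key, smul_inv_smul]
  · rintro ⟨v, hv, hu⟩
    refine ⟨π • v, by rwa [inv_smul_smul], ?_⟩
    rwa [key, Set.mem_smul_set_iff_inv_smul_mem]

/-- Substitution adds up star-heights. -/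
theorem StarHeightLE.substitute [OrbitFiniteAlphabet Atom Γ] {n m : ℕ} {X : Set (Γ →₀ ℕ)}
    (hX : StarHeightLE Atom n X) {T : Finset Atom} {f : Γ → Set (Γ' →₀ ℕ)}
    (hf : SetEquivariant T f) (hm : ∀ σ, StarHeightLE Atom m (f σ)) :
    StarHeightLE Atom (n + m) (substitute f X) := by
  classical
  induction hX with
  | zero n =>
    rw [substitute_zero]
    exact .zero _
  | single n σ =>
    have : BlockParikh.substitute f {Finsupp.single σ 1} = f σ := by
      simp [BlockParikh.substitute]
    rw [this]
    exact (hm σ).mono (Nat.le_add_left _ _)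
  | add _ _ ih ih' =>
    rw [substitute_add]
    exact .add ih ih'
  | @star n _ _ ih =>
    rw [substitute_kleeneStar, Nat.add_right_comm]
    exact .star ih
  | @sUnion n F hF h ih =>
    obtain ⟨T', hT'⟩ := hF.supports
    have hfew : Few (T ∪ T') F := hF.few (fun X hX => by
      obtain ⟨V, hV⟩ := (h X hX).supported
      exact ⟨V, fun π hπ => hV.smul_eq hπ⟩) _
    have : BlockParikh.substitute f (⋃₀ F) = ⋃₀ (BlockParikh.substitute f '' F) := by
      simp only [BlockParikh.substitute, Set.sUnion_image]
      rw [Set.sUnion_eq_biUnion]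
      simp only [Set.biUnion_iUnion]
    rw [this]
    refine .sUnion ((hfew.image _ fun π hπ X => substitute_smul hf
      (hπ.mono Finset.subset_union_left) X).orbitFinite (T := T ∪ T') ?_) ?_
    · rintro π hπ _ ⟨X, hX, rfl⟩
      exact ⟨π • X, hT' π (hπ.mono Finset.subset_union_right) X hX,
        substitute_smul hf (hπ.mono Finset.subset_union_left) X⟩
    · rintro _ ⟨X, hX, rfl⟩
      exact ih X hX

end StarHeight

/-! ### The infixes of an altering set -/

section Trace

open scoped Classical

variable {S Atom : Type*} {k : ℕ}

/-- `Traced c w c' l`: the word `w` is an altering set from `c` to `c'`, and `l` lists, in order,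
the data `((t, s), (a, B ∪ {b}))` of its infixes `⟨·,a,t⟩⟨t,B,s⟩⟨s,b,·⟩`. -/
inductive Traced :
    S × Atom → List (AltLetter S Atom k) → S × Atom → List ((S × S) × (Atom × Finset Atom)) → Prop
  | single (s : S) (a : Atom) (t : S) : Traced (s, a) [.point s a t] (t, a) []
  | cons {s : S} {a : Atom} {t : S} {B : Finset Atom} {hB : B.card = k} {s' : S} {a' : Atom}
      {w : List (AltLetter S Atom k)} {c' : S × Atom} {l : List ((S × S) × (Atom × Finset Atom))} :
      a ≠ a' → a ∉ B → a' ∉ B → Traced (s', a') w c' l →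
      Traced (s, a) (.point s a t :: .block t B hB s' :: w) c' (((t, s'), (a, insert a' B)) :: l)

theorem Altering.traced {c c' : S × Atom} {w : List (AltLetter S Atom k)} (h : Altering c w c') :
    ∃ l, Traced c w c' l := by
  induction h with
  | single s a t => exact ⟨[], .single s a t⟩
  | cons h₁ h₂ h₃ _ ih =>
    obtain ⟨l, hl⟩ := ih
    exact ⟨_, .cons h₁ h₂ h₃ hl⟩

theorem Traced.altering {c c' : S × Atom} {w : List (AltLetter S Atom k)}
    {l : List ((S × S) × (Atom × Finset Atom))} (h : Traced c w c' l) : Altering c w c' := by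
  induction h with
  | single s a t => exact .single s a t
  | cons h₁ h₂ h₃ _ ih => exact .cons h₁ h₂ h₃ ih

theorem Traced.length {c c' : S × Atom} {w : List (AltLetter S Atom k)}
    {l : List ((S × S) × (Atom × Finset Atom))} (h : Traced c w c' l) :
    w.length = 2 * l.length + 1 := by
  induction h with
  | single s a t => rfl
  | cons _ _ _ _ ih =>
    simp only [List.length_cons, ih]
    omega

theorem Traced.exists_eq_cons {c c' : S × Atom} {w : List (AltLetter S Atom k)}
    {l : List ((S × S) × (Atom × Finset Atom))} (h : Traced c w c' l) :
    ∃ t w', w = .point c.1 c.2 t :: w' := by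
  cases h with
  | single s a t => exact ⟨t, [], rfl⟩
  | cons _ _ _ _ => exact ⟨_, _, rfl⟩

theorem Traced.inducedSet_eq {c c' : S × Atom} {w : List (AltLetter S Atom k)}
    {l : List ((S × S) × (Atom × Finset Atom))} (h : Traced c w c' l) (t s : S) :
    inducedSet w t s = {θ | ((t, s), θ) ∈ l} := by
  induction h with
  | single s₀ a₀ t₀ =>
    ext θ
    simp only [inducedSet, Set.mem_ofPred_eq, List.not_mem_nil, iff_false]
    rintro ⟨s', a, B, hB, c, t', h, -⟩
    simpa using h.length_le
  | @cons s₀ a₀ t₀ B₀ hB₀ s₁ a₁ w c' l h₁ h₂ h₃ h₄ ih =>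
    obtain ⟨t₁, w', rfl⟩ := h₄.exists_eq_cons
    ext θ
    rw [Set.mem_ofPred_eq, List.mem_cons]
    have ih' := Set.ext_iff.1 ih θ
    rw [Set.mem_ofPred_eq] at ih'
    rw [← ih']
    constructor
    · rintro ⟨s', a, B, hB, c, t', h, rfl⟩
      rw [List.infix_cons_iff, List.infix_cons_iff] at h
      rcases h with h | h | h
      · rw [List.cons_prefix_cons, List.cons_prefix_cons, List.cons_prefix_cons] at h
        obtain ⟨e₁, e₂, e₃, -⟩ := h
        injection e₁ with _ e₁ _
        injection e₂ with e₂ e₄ e₅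
        injection e₃ with _ e₃ _
        subst e₁ e₂ e₄ e₅ e₃
        exact Or.inl rfl
      · rw [List.cons_prefix_cons] at h
        exact absurd h.1 (by simp)
      · exact Or.inr ⟨s', a, B, hB, c, t', h, rfl⟩
    · rintro (h | ⟨s', a, B, hB, c, t', h, rfl⟩)
      · simp only [Prod.mk.injEq] at h
        obtain ⟨⟨rfl, rfl⟩, rfl⟩ := h
        exact ⟨s₀, a₀, B₀, hB₀, a₁, t₁, ⟨[], w', rfl⟩, rfl⟩
      · refine ⟨s', a, B, hB, c, t', ?_, rfl⟩
        rw [List.infix_cons_iff, List.infix_cons_iff]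
        exact Or.inr (Or.inr h)

theorem Traced.valid {c c' : S × Atom} {w : List (AltLetter S Atom k)}
    {l : List ((S × S) × (Atom × Finset Atom))} (h : Traced c w c' l) :
    ∀ x ∈ l, x.2.1 ∉ x.2.2 ∧ x.2.2.card = k + 1 := by
  induction h with
  | single s a t => simp
  | @cons s₀ a₀ t₀ B₀ hB₀ s₁ a₁ w c' l h₁ h₂ h₃ h₄ ih =>
    rw [List.forall_mem_cons]
    refine ⟨⟨by simp [h₁, h₂], ?_⟩, ih⟩
    rw [Finset.card_insert_of_notMem h₃, hB₀]

theorem Traced.append {c c' : S × Atom} {t s : S} {a b : Atom} {B : Finset Atom} (hB : B.card = k)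
    {w w' : List (AltLetter S Atom k)} {l l' : List ((S × S) × (Atom × Finset Atom))}
    (h : Traced c w (t, a) l) (h' : Traced (s, b) w' c' l') (hab : a ≠ b) (ha : a ∉ B)
    (hb : b ∉ B) :
    Traced c (w ++ .block t B hB s :: w') c' (l ++ ((t, s), (a, insert b B)) :: l') := by
  generalize hd : (t, a) = d at h
  induction h with
  | single s₀ a₀ t₀ =>
    simp only [Prod.mk.injEq] at hd
    obtain ⟨rfl, rfl⟩ := hd
    exact .cons hab ha hb h'
  | cons h₁ h₂ h₃ _ ih => exact .cons h₁ h₂ h₃ (ih hd)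

theorem Traced.split {c c' : S × Atom} {t s : S} {a : Atom} {C : Finset Atom}
    {w : List (AltLetter S Atom k)} {l₁ l₂ : List ((S × S) × (Atom × Finset Atom))}
    (h : Traced c w c' (l₁ ++ ((t, s), (a, C)) :: l₂)) :
    ∃ (w₁ w₂ : List (AltLetter S Atom k)) (B : Finset Atom) (hB : B.card = k) (b : Atom),
      w = w₁ ++ .block t B hB s :: w₂ ∧ Traced c w₁ (t, a) l₁ ∧ Traced (s, b) w₂ c' l₂ ∧
      C = insert b B ∧ b ∉ B := by
  generalize hl : l₁ ++ ((t, s), (a, C)) :: l₂ = l at h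
  induction h generalizing l₁ with
  | single s a t => simp at hl
  | @cons s₀ a₀ t₀ B₀ hB₀ s₁ a₁ w c' l h₁ h₂ h₃ h₄ ih =>
    rcases l₁ with _ | ⟨x, l₁⟩
    · simp only [List.nil_append, List.cons.injEq, Prod.mk.injEq] at hl
      obtain ⟨⟨⟨rfl, rfl⟩, rfl, rfl⟩, rfl⟩ := hl
      exact ⟨[.point s₀ a t], w, B₀, hB₀, a₁, rfl, .single s₀ a t, h₄, rfl, h₃⟩
    · simp only [List.cons_append, List.cons.injEq] at hl
      obtain ⟨rfl, hl⟩ := hl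
      obtain ⟨w₁, w₂, B, hB, b, rfl, h₅, h₆, h₇⟩ := ih hl
      exact ⟨_, w₂, B, hB, b, rfl, .cons h₁ h₂ h₃ h₅, h₆, h₇⟩

/-- Renaming of the atoms in a pair. -/
def renamePair (π : Equiv.Perm Atom) (θ : Atom × Finset Atom) : Atom × Finset Atom :=
  (π θ.1, θ.2.map π.toEmbedding)

theorem Traced.map {c c' : S × Atom} {w : List (AltLetter S Atom k)}
    {l : List ((S × S) × (Atom × Finset Atom))} (h : Traced c w c' l) (π : Equiv.Perm Atom) :
    Traced (c.1, π c.2) (w.map (π • ·)) (c'.1, π c'.2)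
      (l.map fun x => (x.1, renamePair π x.2)) := by
  induction h with
  | single s a t => exact .single s (π a) t
  | @cons s₀ a₀ t₀ B₀ hB₀ s₁ a₁ w c' l h₁ h₂ h₃ h₄ ih =>
    have := Traced.cons (s := s₀) (t := t₀) (B := B₀.map π.toEmbedding)
      (hB := (Finset.card_map _).trans hB₀) (fun h => h₁ (π.injective h))
      (by simpa using h₂) (by simpa using h₃) ih
    have e : insert (π a₁) (B₀.map π.toEmbedding) = (insert a₁ B₀).map π.toEmbedding := by
      rw [Finset.map_insert]
      rfl
    rw [e] at this
    exact this

theorem Altering.map {c c' : S × Atom} {w : List (AltLetter S Atom k)} (h : Altering c w c')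
    (π : Equiv.Perm Atom) : Altering (c.1, π c.2) (w.map (π • ·)) (c'.1, π c'.2) := by
  obtain ⟨l, hl⟩ := h.traced
  exact (hl.map π).altering

theorem Altering.inducedSet_map {c c' : S × Atom} {w : List (AltLetter S Atom k)}
    (h : Altering c w c') (π : Equiv.Perm Atom) (t s : S) :
    inducedSet (w.map (π • ·)) t s = renamePair π '' inducedSet w t s := by
  obtain ⟨l, hl⟩ := h.traced
  rw [hl.inducedSet_eq, (hl.map π).inducedSet_eq]
  ext θ
  simp only [Set.mem_ofPred_eq, List.mem_map, Set.mem_image, Prod.mk.injEq]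
  constructor
  · rintro ⟨⟨x, θ'⟩, h, rfl, rfl⟩
    exact ⟨θ', h, rfl⟩
  · rintro ⟨θ', h, rfl⟩
    exact ⟨_, h, rfl, rfl⟩

end Trace

/-! ### Good controls -/

section GoodControl

open scoped Classical

variable {Atom : Type*}

theorem weakControl_iff {X Y : Finset Atom} {A : Set (Atom × Finset Atom)} {τ : ControlType} :
    WeakControl X Y A τ ↔ ∀ θ ∈ A, InsertionCondition X Y θ τ := by
  cases τ <;>
    simp [WeakControl, InsertionCondition, Controls, Set.eq_empty_iff_forall_notMem]

theorem GoodControl.insertionCondition {p : ℕ} {X Y : Finset Atom} {A : Set (Atom × Finset Atom)}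
    {τ : ControlType} (h : GoodControl p X Y A τ) : ∀ θ ∈ A, InsertionCondition X Y θ τ := by
  cases τ with
  | null =>
    intro θ hθ
    rw [show A = ∅ from h] at hθ
    exact hθ
  | left => exact h.2.2.2.1
  | right => exact h.2.2.2.1
  | full => exact h.2.2.2.1
  | unrestrained => exact h.2.1

theorem Unrestrained.mono {q : ℕ} {A A' : Set (Atom × Finset Atom)} (h : Unrestrained q A)
    (hA : A ⊆ A') : Unrestrained q A' := fun z W hW hz => by
  obtain ⟨θ, hθ, h'⟩ := h z W hW hz
  exact ⟨θ, hA hθ, h'⟩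

theorem reduction_mono {A A' : Set (Atom × Finset Atom)} {X Y Y' : Finset Atom} (hA : A ⊆ A')
    (hY : Y' ⊆ Y) : reduction A X Y ⊆ reduction A' X Y' := by
  rintro θ ⟨B, h₁, h₂, h₃⟩
  exact ⟨B, hA h₁, fun h => h₂ (hY h), h₃⟩

theorem controls_of_eq_right {X Y : Finset Atom} {A : Set (Atom × Finset Atom)}
    (h : ∀ θ ∈ A, θ.1 ∈ Y ∨ θ.2 = X) : Controls X Y A := fun θ hθ =>
  (h θ hθ).imp_right fun h => h.ge

/-- Good control passes to larger sets that are weakly controlled. -/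
theorem GoodControl.mono {p : ℕ} {X Y : Finset Atom} {A A' : Set (Atom × Finset Atom)}
    {τ : ControlType} (h : GoodControl p X Y A τ) (hA : A ⊆ A')
    (hc : ∀ θ ∈ A', InsertionCondition X Y θ τ) : GoodControl p X Y A' τ := by
  cases τ with
  | null => exact Set.eq_empty_iff_forall_notMem.2 hc
  | left =>
    exact ⟨h.1.mono hA, fun θ hθ => Or.inl (hc θ hθ), h.2.2.1, hc,
      fun y hy => (h.2.2.2.2 y hy).imp fun B hB => hA hB⟩
  | right =>
    exact ⟨h.1.mono hA, controls_of_eq_right fun θ hθ => Or.inr (hc θ hθ), h.2.2.1, hc,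
      h.2.2.2.2.imp fun a ha => hA ha⟩
  | full =>
    exact ⟨h.1.mono hA, controls_of_eq_right hc, h.2.2.1, hc,
      fun y hy => (h.2.2.2.2.1 y hy).imp fun B hB => hA hB,
      h.2.2.2.2.2.imp fun a ha => hA ha⟩
  | unrestrained =>
    exact ⟨h.1.mono hA, hc, h.2.2.1,
      fun y hy => (h.2.2.2.1 y hy).imp fun B hB => hA hB,
      h.2.2.2.2.mono (reduction_mono hA subset_rfl)⟩

/-- Starting from a control `(X, Y)`, as long as the reduction is restrained by some `(z, W)`, the
atom `z` is moved to `X` and the atoms of `W` to `Y`; the binomials bound the growth of `Y`. -/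
theorem Controls.exists_goodControl [Infinite Atom] {p : ℕ} {A : Set (Atom × Finset Atom)}
    (hne : A.Nonempty) (hA : ∀ θ ∈ A, θ.2.card = p) (q : ℕ) (X Y : Finset Atom)
    (hX : X.card + q = p) (hY : Y.card + (q + 1).choose 2 ≤ (p + 1).choose 2)
    (hc : Controls X Y A) :
    ∃ (τ : ControlType) (X' Y' : Finset Atom), X'.card ≤ p ∧ Y'.card ≤ (p + 1).choose 2 ∧
      GoodControl p X' Y' A τ := by
  -- In a good control, `Y` consists of first components only.
  have trim (X Y : Finset Atom) (hc : Controls X Y A) :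
      Controls X (Y.filter fun y => ∃ B, (y, B) ∈ A) A ∧
      ∀ y ∈ Y.filter fun y => ∃ B, (y, B) ∈ A, ∃ B, (y, B) ∈ A :=
    ⟨fun θ hθ => (hc θ hθ).imp_left fun h => Finset.mem_filter.2 ⟨h, θ.2, hθ⟩,
      fun y hy => (Finset.mem_filter.1 hy).2⟩
  induction q generalizing X Y with
  | zero =>
    have hY' : (Y.filter fun y => ∃ B, (y, B) ∈ A).card ≤ (p + 1).choose 2 :=
      (Finset.card_filter_le _ _).trans (by omega)
    obtain ⟨h₁, h₂⟩ := trim X Y hc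
    by_cases h : ∀ θ ∈ A, θ.1 ∈ Y.filter fun y => ∃ B, (y, B) ∈ A
    · exact ⟨.left, X, _, hX.le, hY', hne, h₁, hX, h, h₂⟩
    · push Not at h
      have heq : ∀ θ ∈ A, X ⊆ θ.2 → θ.2 = X := fun θ hθ h =>
        (Finset.eq_of_subset_of_card_le h (by rw [hA θ hθ]; omega)).symm
      obtain ⟨θ, hθ, h⟩ := h
      have := heq θ hθ ((h₁ θ hθ).resolve_left h)
      exact ⟨.full, X, _, hX.le, hY', hne, h₁, hX,
        fun θ hθ => (h₁ θ hθ).imp_right (heq θ hθ), h₂, θ.1, by rwa [← this]⟩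
  | succ q ih =>
    by_cases hu : Unrestrained (p - X.card) (reduction A X Y)
    · obtain ⟨h₁, h₂⟩ := trim X Y hc
      exact ⟨.unrestrained, X, _, by omega, (Finset.card_filter_le _ _).trans (by omega), hne, h₁,
        by omega, h₂, hu.mono (reduction_mono subset_rfl (Finset.filter_subset _ _))⟩
    · simp only [Unrestrained] at hu
      push Not at hu
      obtain ⟨z, W, hW, hz, hr⟩ := hu
      -- If `z ∈ X`, then `z` does not help to restrain the reduction, and any new atom will do.
      obtain ⟨z', hz', hzz⟩ : ∃ z' ∉ X, z ∉ X → z' = z := by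
        by_cases h : z ∈ X
        · obtain ⟨z', hz'⟩ := Infinite.exists_notMem_finset X
          exact ⟨z', hz', fun h' => absurd h h'⟩
        · exact ⟨z, h, fun _ => rfl⟩
      have hcX : (insert z' X).card = X.card + 1 := Finset.card_insert_of_notMem hz'
      have hcY := Finset.card_union_le Y W
      have hch : (q + 1 + 1).choose 2 = (q + 1) + (q + 1).choose 2 := by
        rw [Nat.choose_succ_succ' (q + 1) 1, Nat.choose_one_right]
      refine ih (insert z' X) (Y ∪ W) (by omega) (by omega) ?_
      · intro θ hθ
        by_cases hY : θ.1 ∈ Y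
        · exact Or.inl (Finset.mem_union_left _ hY)
        have hXθ := (hc θ hθ).resolve_left hY
        by_cases hW : θ.1 ∈ W
        · exact Or.inl (Finset.mem_union_right _ hW)
        have := hr (θ.1, θ.2 \ X) ⟨θ.2, hθ, hY, rfl⟩ hW
        rw [Finset.mem_sdiff] at this
        rw [hzz this.2]
        exact Or.inr (Finset.insert_subset this.1 hXθ)

theorem exists_goodControl [Infinite Atom] {p : ℕ} {A : Set (Atom × Finset Atom)}
    (hA : ∀ θ ∈ A, θ.2.card = p) :
    ∃ (τ : ControlType) (X Y : Finset Atom), X.card ≤ p ∧ Y.card ≤ (p + 1).choose 2 ∧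
      GoodControl p X Y A τ := by
  rcases A.eq_empty_or_nonempty with rfl | hne
  · exact ⟨.null, ∅, ∅, by simp, by simp, rfl⟩
  · exact Controls.exists_goodControl hne hA p ∅ ∅ (by simp) (by simp) fun θ _ =>
      Or.inr (Finset.empty_subset _)

/-- An atom `z` takes part in no restraining pair of an unrestrained set because of at most `q + 1`
elements of the set. -/
theorem Unrestrained.exists_finset_atom [Infinite Atom] {q : ℕ} {A : Set (Atom × Finset Atom)}
    (h : Unrestrained q A) (z : Atom) :
    ∃ V : Finset (Atom × Finset Atom), (V : Set (Atom × Finset Atom)) ⊆ A ∧ V.card ≤ q + 1 ∧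
      (∀ θ ∈ V, z ∉ θ.2) ∧ ((∃ θ ∈ V, θ.1 = z) ∨ (V.image Prod.fst).card = q + 1) := by
  let F : Set Atom := {a | ∃ C, (a, C) ∈ A ∧ z ∉ C}
  by_cases hz : z ∈ F
  · obtain ⟨C, hC, hzC⟩ := hz
    exact ⟨{(z, C)}, by simpa using hC, by simp, by simpa using hzC, Or.inl ⟨(z, C), by simp⟩⟩
  by_cases hF : ∃ G : Finset Atom, G.card = q + 1 ∧ (G : Set Atom) ⊆ F
  · obtain ⟨G, hG, hGF⟩ := hF
    have hGF' : ∀ a ∈ G, ∃ C, (a, C) ∈ A ∧ z ∉ C := fun a ha => hGF ha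
    choose! C hC using hGF'
    refine ⟨G.image fun a => (a, C a), ?_, Finset.card_image_le.trans hG.le, ?_, Or.inr ?_⟩
    · intro θ hθ
      obtain ⟨a, ha, rfl⟩ := Finset.mem_image.1 (Finset.mem_coe.1 hθ)
      exact (hC a ha).1
    · intro θ hθ
      obtain ⟨a, ha, rfl⟩ := Finset.mem_image.1 hθ
      exact (hC a ha).2
    · rw [Finset.image_image]
      simpa [Function.comp_def] using hG
  · -- Now `z` and an extension of `F` restrain `A`.
    exfalso
    have hfin : F.Finite := by
      by_contra hinf
      obtain ⟨G, h₁, h₂⟩ := Set.Infinite.exists_subset_card_eq hinf (q + 1)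
      exact hF ⟨G, h₂, h₁⟩
    have hcard : hfin.toFinset.card ≤ q := by
      by_contra hlt
      obtain ⟨G, h₁, h₂⟩ := Finset.exists_subset_card_eq (Nat.lt_of_not_le hlt)
      exact hF ⟨G, h₂, fun a ha => hfin.mem_toFinset.1 (h₁ ha)⟩
    have hz' : z ∉ hfin.toFinset := fun h => hz (hfin.mem_toFinset.1 h)
    obtain ⟨W, hW, hWc⟩ := Infinite.exists_superset_card_eq (insert z hfin.toFinset) (q + 1) (by
      rw [Finset.card_insert_of_notMem hz']
      omega)
    have hzW : z ∈ W := hW (Finset.mem_insert_self _ _)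
    obtain ⟨θ, hθ, h₁, h₂⟩ := h z (W.erase z) (by
      rw [Finset.card_erase_of_mem hzW, hWc, Nat.add_sub_cancel]) (Finset.notMem_erase z W)
    have hθF : θ.1 ∈ F := ⟨θ.2, hθ, h₂⟩
    refine h₁ (Finset.mem_erase.2 ⟨fun e => hz (e ▸ hθF), hW ?_⟩)
    exact Finset.mem_insert_of_mem (hfin.mem_toFinset.2 hθF)

/-- A finite unrestrained set has an unrestrained subset of bounded size: elements with `q + 1`
distinct first components deal with the atoms outside of their second components, and each of the
finitely many remaining atoms is dealt with on its own. -/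
theorem Unrestrained.exists_finset [Infinite Atom] {q r : ℕ} {A : Set (Atom × Finset Atom)}
    (h : Unrestrained q A) (hfin : A.Finite) (hr : ∀ θ ∈ A, θ.2.card ≤ r) :
    ∃ V : Finset (Atom × Finset Atom), (V : Set (Atom × Finset Atom)) ⊆ A ∧
      V.card ≤ (q + 1) + (q + 1) * r * (q + 1) ∧
      Unrestrained q (V : Set (Atom × Finset Atom)) := by
  choose V hVA hVc hVz hV using h.exists_finset_atom
  obtain ⟨z₀, hz₀⟩ := Infinite.exists_notMem_finset (hfin.toFinset.image Prod.fst)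
  have hz₀V : ((V z₀).image Prod.fst).card = q + 1 := (hV z₀).resolve_left fun ⟨θ, hθ, e⟩ =>
    hz₀ (Finset.mem_image.2 ⟨θ, hfin.mem_toFinset.2 (hVA z₀ hθ), e⟩)
  -- A set with `q + 1` first components has one outside of `W`.
  have key (z : Atom) (W : Finset Atom) (hW : W.card = q)
      (hz : ((V z).image Prod.fst).card = q + 1) : ∃ θ ∈ V z, θ.1 ∉ W := by
    obtain ⟨a, ha, haW⟩ := Finset.exists_mem_notMem_of_card_lt_card
      (show W.card < ((V z).image Prod.fst).card by omega)
    obtain ⟨θ, hθ, rfl⟩ := Finset.mem_image.1 ha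
    exact ⟨θ, hθ, haW⟩
  refine ⟨V z₀ ∪ ((V z₀).biUnion Prod.snd).biUnion V, ?_, ?_, fun z W hW hz => ?_⟩
  · intro θ hθ
    rcases Finset.mem_union.1 (Finset.mem_coe.1 hθ) with h | h
    · exact hVA z₀ h
    · obtain ⟨z, -, h⟩ := Finset.mem_biUnion.1 h
      exact hVA z h
  · refine (Finset.card_union_le _ _).trans (Nat.add_le_add (hVc z₀) ?_)
    refine (Finset.card_biUnion_le_card_mul _ _ _ fun z _ => hVc z).trans ?_
    refine Nat.mul_le_mul_right _ ?_
    exact (Finset.card_biUnion_le_card_mul _ _ _ fun θ hθ => hr θ (hVA z₀ hθ)).trans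
      (Nat.mul_le_mul_right _ (hVc z₀))
  · by_cases hzV : z ∈ (V z₀).biUnion Prod.snd
    · have hsub : V z ⊆ V z₀ ∪ ((V z₀).biUnion Prod.snd).biUnion V :=
        (Finset.subset_biUnion_of_mem V hzV).trans Finset.subset_union_right
      rcases hV z with ⟨θ, hθ, rfl⟩ | hz'
      · exact ⟨θ, hsub hθ, hz, hVz _ θ hθ⟩
      · obtain ⟨θ, hθ, hθW⟩ := key z W hW hz'
        exact ⟨θ, hsub hθ, hθW, hVz z θ hθ⟩
    · obtain ⟨θ, hθ, hθW⟩ := key z₀ W hW hz₀V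
      exact ⟨θ, Finset.mem_union_left _ hθ, hθW,
        fun hz => hzV (Finset.mem_biUnion.2 ⟨θ, hθ, hz⟩)⟩

/-- Good control of a finite set is already witnessed by a subset of bounded size. -/
theorem GoodControl.exists_finset [Infinite Atom] {p : ℕ} {X Y : Finset Atom}
    {A : Set (Atom × Finset Atom)} {τ : ControlType} (h : GoodControl p X Y A τ) (hfin : A.Finite)
    (hp : ∀ θ ∈ A, θ.2.card = p) :
    ∃ V : Finset (Atom × Finset Atom), (V : Set (Atom × Finset Atom)) ⊆ A ∧
      V.card ≤ Y.card + 1 + ((p + 1) + (p + 1) * p * (p + 1)) ∧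
      GoodControl p X Y (V : Set (Atom × Finset Atom)) τ := by
  have hic := h.insertionCondition
  -- Elements of `A` with all elements of `Y` as first components.
  have hYV (hY : ∀ y ∈ Y, ∃ B, (y, B) ∈ A) : ∃ V : Finset (Atom × Finset Atom),
      (V : Set (Atom × Finset Atom)) ⊆ A ∧ V.card ≤ Y.card ∧ ∀ y ∈ Y, ∃ B, (y, B) ∈ V := by
    choose! C hC using hY
    refine ⟨Y.image fun y => (y, C y), fun θ hθ => ?_, Finset.card_image_le,
      fun y hy => ⟨C y, Finset.mem_image_of_mem (fun y => (y, C y)) hy⟩⟩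
    obtain ⟨a, ha, rfl⟩ := Finset.mem_image.1 (Finset.mem_coe.1 hθ)
    exact hC a ha
  cases τ with
  | null => exact ⟨∅, by simp, by simp, by simp [GoodControl]⟩
  | left =>
    obtain ⟨⟨θ, hθ⟩, h₁, h₂, h₃, h₄⟩ := h
    obtain ⟨V, hVA, hVc, hV⟩ := hYV h₄
    have hsub : ((insert θ V : Finset _) : Set (Atom × Finset Atom)) ⊆ A := by
      rw [Finset.coe_insert]
      exact Set.insert_subset hθ hVA
    refine ⟨insert θ V, hsub, (Finset.card_insert_le _ _).trans (by omega), ⟨θ, by simp⟩,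
      fun θ hθ => h₁ θ (hsub hθ), h₂, fun θ hθ => h₃ θ (hsub hθ), fun y hy => ?_⟩
    exact (hV y hy).imp fun B hB => Finset.mem_insert_of_mem hB
  | right =>
    obtain ⟨-, h₁, h₂, h₃, a, ha⟩ := h
    have hsub : (({(a, X)} : Finset _) : Set (Atom × Finset Atom)) ⊆ A := by simpa using ha
    exact ⟨{(a, X)}, hsub, by rw [Finset.card_singleton]; omega, ⟨(a, X), by simp⟩,
      fun θ hθ => h₁ θ (hsub hθ), h₂, fun θ hθ => h₃ θ (hsub hθ), a, by simp⟩
  | full =>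
    obtain ⟨-, h₁, h₂, h₃, h₄, a, ha⟩ := h
    obtain ⟨V, hVA, hVc, hV⟩ := hYV h₄
    have hsub : ((insert (a, X) V : Finset _) : Set (Atom × Finset Atom)) ⊆ A := by
      rw [Finset.coe_insert]
      exact Set.insert_subset ha hVA
    refine ⟨insert (a, X) V, hsub, (Finset.card_insert_le _ _).trans (by omega),
      ⟨(a, X), by simp⟩, fun θ hθ => h₁ θ (hsub hθ), h₂, fun θ hθ => h₃ θ (hsub hθ),
      fun y hy => ?_, a, by simp⟩
    exact (hV y hy).imp fun B hB => Finset.mem_insert_of_mem hB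
  | unrestrained =>
    obtain ⟨⟨θ, hθ⟩, h₁, h₂, h₃, h₄⟩ := h
    obtain ⟨V, hVA, hVc, hV⟩ := hYV h₃
    have hred : ∀ θ ∈ reduction A X Y, ∃ B, (θ.1, B) ∈ A ∧ θ.1 ∉ Y ∧ θ.2 = B \ X := fun _ h => h
    choose! C hC using hred
    have hfin' : (reduction A X Y).Finite := by
      refine (hfin.image fun θ => (θ.1, θ.2 \ X)).subset ?_
      rintro ⟨a, B⟩ ⟨B', h₁, -, h₂⟩
      exact ⟨(a, B'), h₁, Prod.ext rfl h₂.symm⟩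
    obtain ⟨U, hUA, hUc, hU⟩ := h₄.exists_finset (r := p) hfin' (by
      rintro ⟨a, B⟩ ⟨B', h₁, -, h₂⟩
      rw [h₂, ← hp _ h₁]
      exact Finset.card_le_card Finset.sdiff_subset)
    have hUc' : (U.image fun θ => (θ.1, C θ)).card ≤ (p + 1) + (p + 1) * p * (p + 1) :=
      Finset.card_image_le.trans (hUc.trans (by gcongr <;> omega))
    have hsub : ((insert θ V ∪ U.image fun θ => (θ.1, C θ) : Finset _) :
        Set (Atom × Finset Atom)) ⊆ A := by
      rw [Finset.coe_union, Finset.coe_insert, Finset.coe_image]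
      refine Set.union_subset (Set.insert_subset hθ hVA) ?_
      rintro _ ⟨θ, hθ, rfl⟩
      exact (hC θ (hUA hθ)).1
    refine ⟨insert θ V ∪ U.image fun θ => (θ.1, C θ), hsub, ?_, ⟨θ, by simp⟩,
      fun θ hθ => h₁ θ (hsub hθ), h₂, fun y hy => ?_, hU.mono fun θ hθ => ?_⟩
    · refine (Finset.card_union_le _ _).trans (Nat.add_le_add ?_ hUc')
      exact (Finset.card_insert_le _ _).trans (by omega)
    · refine (hV y hy).imp fun B hB => ?_
      exact Finset.mem_union_left _ (Finset.mem_insert_of_mem hB)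
    · refine ⟨C θ, ?_, (hC θ (hUA hθ)).2⟩
      exact Finset.mem_union_right _ (Finset.mem_image_of_mem (fun θ => (θ.1, C θ)) hθ)

/-- A pair `(d, W)` that meets the insertion condition can be inserted at some `(a, C) ∈ A`, and the
exchange of `(a, C)` for `(a, W)` and `(d, C)` preserves good control. -/
theorem GoodControl.exists_insertion {p : ℕ} {X Y : Finset Atom} {A : Set (Atom × Finset Atom)}
    {τ : ControlType} (h : GoodControl p X Y A τ)
    (hA : ∀ θ ∈ A, θ.1 ∉ θ.2 ∧ θ.2.card = p) {d : Atom} {W : Finset Atom} (hd : d ∉ W)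
    (hW : W.card = p) (hi : InsertionCondition X Y (d, W) τ) :
    ∃ (a : Atom) (C : Finset Atom), (a, C) ∈ A ∧ a ∉ W ∧ d ∉ C ∧
      GoodControl p X Y (A \ {(a, C)} ∪ {(a, W), (d, C)}) τ := by
  have hic := h.insertionCondition
  have hmono {a : Atom} {C : Finset Atom} (hsub : A ⊆ A \ {(a, C)} ∪ {(a, W), (d, C)})
      (h₁ : InsertionCondition X Y (a, W) τ) (h₂ : InsertionCondition X Y (d, C) τ) :
      GoodControl p X Y (A \ {(a, C)} ∪ {(a, W), (d, C)}) τ := by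
    refine h.mono hsub ?_
    rintro θ (hθ | rfl | rfl)
    · exact hic θ hθ.1
    · exact h₁
    · exact h₂
  by_cases hdA : ∃ C, (d, C) ∈ A
  · obtain ⟨C, hC⟩ := hdA
    refine ⟨d, C, hC, hd, (hA _ hC).1, hmono (fun θ hθ => ?_) hi (hic _ hC)⟩
    by_cases h : θ = (d, C)
    · exact Or.inr (Or.inr h)
    · exact Or.inl ⟨hθ, h⟩
  by_cases hWA : ∃ a, (a, W) ∈ A
  · obtain ⟨a, ha⟩ := hWA
    refine ⟨a, W, ha, (hA _ ha).1, hd, hmono (fun θ hθ => ?_) (hic _ ha) hi⟩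
    by_cases h : θ = (a, W)
    · exact Or.inr (Or.inl h)
    · exact Or.inl ⟨hθ, h⟩
  cases τ with
  | null => exact hi.elim
  | left => exact absurd (h.2.2.2.2 d hi) hdA
  | right =>
    obtain rfl : W = X := hi
    exact absurd h.2.2.2.2 hWA
  | full =>
    rcases hi with hi | hi
    · exact absurd (h.2.2.2.2.1 d hi) hdA
    · obtain rfl : W = X := hi
      exact absurd h.2.2.2.2.2 hWA
  | unrestrained =>
    obtain ⟨hne, hc, hX, hY, hu⟩ := h
    have hdY : d ∉ Y := fun hd => hdA (hY d hd)
    have hXW : X ⊆ W := hi.resolve_left hdY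
    have hq : (W \ X).card = p - X.card := by rw [Finset.card_sdiff_of_subset hXW, hW]
    obtain ⟨⟨a, _⟩, ⟨C, haC, haY, rfl⟩, haW', hdC'⟩ := hu d (W \ X) hq fun h =>
      hd (Finset.mem_sdiff.1 h).1
    have hXC : X ⊆ C := (hc _ haC).resolve_left haY
    have haX : a ∉ X := fun h => (hA _ haC).1 (hXC h)
    have hdX : d ∉ X := fun h => hd (hXW h)
    have haW : a ∉ W := fun h => haW' (Finset.mem_sdiff.2 ⟨h, haX⟩)
    have hdC : d ∉ C := fun h => hdC' (Finset.mem_sdiff.2 ⟨h, hdX⟩)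
    refine ⟨a, C, haC, haW, hdC, ⟨(a, W), Or.inr (Or.inl rfl)⟩, ?_, hX, fun y hy => ?_, ?_⟩
    · rintro θ (hθ | rfl | rfl)
      · exact hc θ hθ.1
      · exact Or.inr hXW
      · exact Or.inr hXC
    · obtain ⟨B, hB⟩ := hY y hy
      refine ⟨B, Or.inl ⟨hB, fun e => ?_⟩⟩
      obtain ⟨rfl, -⟩ := Prod.mk.injEq .. ▸ Set.mem_singleton_iff.1 e
      exact haY hy
    · intro z V hV hz
      -- Elements of `A` other than `(a, C)` are still available.
      have hkeep {b : Atom} {B : Finset Atom} (hb : (b, B) ∈ A) (hbY : b ∉ Y)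
          (hne : (b, B) ≠ (a, C))
          (hbV : b ∉ V) (hz : z ∉ B \ X) :
          ∃ θ ∈ reduction (A \ {(a, C)} ∪ {(a, W), (d, C)}) X Y, θ.1 ∉ V ∧ z ∉ θ.2 :=
        ⟨(b, B \ X), ⟨B, Or.inl ⟨hb, hne⟩, hbY, rfl⟩, hbV, hz⟩
      obtain ⟨⟨b, _⟩, ⟨B, hb, hbY, rfl⟩, hbV, hzB⟩ := hu z V hV hz
      by_cases hne : (b, B) = (a, C)
      swap
      · exact hkeep hb hbY hne hbV hzB
      simp only [Prod.mk.injEq] at hne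
      obtain ⟨rfl, rfl⟩ := hne
      by_cases hdV : d ∉ V
      · exact ⟨(d, B \ X), ⟨B, Or.inr (Or.inr rfl), hdY, rfl⟩, hdV, hzB⟩
      by_cases hzW : z ∉ W \ X
      · exact ⟨(b, W \ X), ⟨W, Or.inr (Or.inl rfl), hbY, rfl⟩, hbV, hzW⟩
      rw [not_not] at hdV hzW
      -- `(z, V)` restrains both new elements; replace `d` by `b` in `V`.
      have hzb : z ≠ b := by
        rintro rfl
        exact haW (Finset.mem_sdiff.1 hzW).1
      have hbV' : b ∉ V.erase d := fun h => hbV (Finset.mem_of_mem_erase h)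
      obtain ⟨⟨e, _⟩, ⟨E, he, heY, rfl⟩, heV, hzE⟩ := hu z (insert b (V.erase d)) (by
        rw [Finset.card_insert_of_notMem hbV', Finset.card_erase_of_mem hdV, hV]
        have := Finset.card_pos.2 ⟨d, hdV⟩
        omega) (by simp [hzb, hz])
      simp only [Finset.mem_insert, Finset.mem_erase, not_or, not_and] at heV
      refine hkeep he heY (fun h => heV.1 (Prod.mk.injEq .. ▸ h).1) (heV.2 ?_) hzE
      rintro rfl
      exact hdA ⟨E, he⟩

/-- Among many pairs that meet the insertion condition there are two whose first components can be
exchanged. -/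
theorem exists_exchange {p : ℕ} {X Y : Finset Atom} {τ : ControlType} {ι : Type*} (I : Finset ι)
    (θ : ι → Atom × Finset Atom) (hθ : ∀ i ∈ I, (θ i).1 ∉ (θ i).2 ∧ (θ i).2.card = p)
    (hc : ∀ i ∈ I, InsertionCondition X Y (θ i) τ) (hI : Y.card + (2 * p + 1) < I.card) :
    ∃ i ∈ I, ∃ j ∈ I, i ≠ j ∧ (θ i).1 ∉ (θ j).2 ∧ (θ j).1 ∉ (θ i).2 ∧
      InsertionCondition X Y ((θ i).1, (θ j).2) τ ∧
      InsertionCondition X Y ((θ j).1, (θ i).2) τ := by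
  by_cases hinj : Set.InjOn (fun i => (θ i).1) I
  swap
  · simp only [Set.InjOn] at hinj
    push Not at hinj
    obtain ⟨i, hi, j, hj, e, hij⟩ := hinj
    refine ⟨i, hi, j, hj, hij, ?_, ?_, ?_, ?_⟩
    · rw [e]; exact (hθ j hj).1
    · rw [← e]; exact (hθ i hi).1
    · rw [e]; exact hc j hj
    · rw [← e]; exact hc i hi
  let J := I.filter fun i => (θ i).1 ∉ Y
  have hJI : J ⊆ I := Finset.filter_subset _ _
  have hJc : 2 * p + 1 < J.card := by
    have h₁ : (I.filter fun i => (θ i).1 ∈ Y).card + J.card = I.card :=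
      Finset.card_filter_add_card_filter_not _
    have h₂ : (I.filter fun i => (θ i).1 ∈ Y).card ≤ Y.card :=
      Finset.card_le_card_of_injOn (fun i => (θ i).1) (fun i hi => (Finset.mem_filter.1 hi).2)
        (hinj.mono (Finset.coe_subset.2 (Finset.filter_subset _ _)))
    omega
  -- In the graph with an edge from `i` to `j` when `(θ i).1 ∈ (θ j).2`, in-degrees are at most `p`.
  obtain ⟨i, hi, j, hj, hij, h₁, h₂⟩ : ∃ i ∈ J, ∃ j ∈ J, i ≠ j ∧ (θ i).1 ∉ (θ j).2 ∧
      (θ j).1 ∉ (θ i).2 := by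
    by_contra hno
    push Not at hno
    have hdeg (j : ι) (hj : j ∈ J) : (J.filter fun i => (θ i).1 ∈ (θ j).2).card ≤ p := by
      rw [← (hθ j (hJI hj)).2]
      exact Finset.card_le_card_of_injOn (fun i => (θ i).1)
        (fun i hi => (Finset.mem_filter.1 hi).2)
        (hinj.mono (Finset.coe_subset.2 ((Finset.filter_subset _ _).trans hJI)))
    have hedge : (J.sigma fun j => J.filter fun i => (θ i).1 ∈ (θ j).2).card ≤ J.card * p := by
      rw [Finset.card_sigma]
      exact (Finset.sum_le_card_nsmul _ _ _ hdeg).trans (by simp)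
    have hsub : J.offDiag ⊆
        ((J.sigma fun j => J.filter fun i => (θ i).1 ∈ (θ j).2).image fun x => (x.1, x.2)) ∪
        ((J.sigma fun j => J.filter fun i => (θ i).1 ∈ (θ j).2).image fun x => (x.2, x.1)) := by
      rintro ⟨i, j⟩ h
      obtain ⟨hi, hj, hij⟩ := Finset.mem_offDiag.1 h
      rw [Finset.mem_union, Finset.mem_image, Finset.mem_image]
      by_cases h₁ : (θ i).1 ∈ (θ j).2
      · exact Or.inr ⟨⟨j, i⟩, by simp [hi, hj, h₁], rfl⟩
      · exact Or.inl ⟨⟨i, j⟩, by simp [hi, hj, hno i hi j hj hij h₁], rfl⟩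
    have h := (Finset.card_le_card hsub).trans (Finset.card_union_le _ _)
    have h' := h.trans (Nat.add_le_add (Finset.card_image_le.trans hedge)
      (Finset.card_image_le.trans hedge))
    rw [Finset.offDiag_card] at h'
    have : J.card * (2 * p + 2) ≤ J.card * J.card := Nat.mul_le_mul_left _ hJc
    have h0 : 0 < J.card := by omega
    have : J.card * (2 * p + 2) = J.card * p + J.card * p + J.card + J.card := by ring
    omega
  have hcross (i : ι) (hi : i ∈ J) (j : ι) (hj : j ∈ J) :
      InsertionCondition X Y ((θ i).1, (θ j).2) τ := by
    have hiY := (Finset.mem_filter.1 hi).2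
    have hjY := (Finset.mem_filter.1 hj).2
    have hi' := hc i (hJI hi)
    have hj' := hc j (hJI hj)
    cases τ with
    | null => exact hi'
    | left => exact hi'
    | right => exact hj'
    | full => exact Or.inr (hj'.resolve_left hjY)
    | unrestrained => exact Or.inr (hj'.resolve_left hjY)
  exact ⟨i, hJI hi, j, hJI hj, hij, h₁, h₂, hcross i hi j hj, hcross j hj i hi⟩

end GoodControl

/-! ### Renaming of controls and of the letters of altering sets -/

section Rename

open scoped Classical

variable {S Atom : Type*} {k : ℕ}

theorem map_eq_self_of_fixes {T W : Finset Atom} (h : W ⊆ T) {π : Equiv.Perm Atom}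
    (hπ : Fixes T π) : W.map π.toEmbedding = W := by
  have : W.map π.toEmbedding ⊆ W := by
    intro a ha
    obtain ⟨b, hb, rfl⟩ := Finset.mem_map.1 ha
    rwa [Equiv.coe_toEmbedding, hπ b (h hb)]
  exact Finset.eq_of_subset_of_card_le this (by simp)

theorem InsertionCondition.rename {X Y : Finset Atom} {θ : Atom × Finset Atom} {τ : ControlType}
    (h : InsertionCondition X Y θ τ) (π : Equiv.Perm Atom) :
    InsertionCondition (X.map π.toEmbedding) (Y.map π.toEmbedding) (renamePair π θ) τ := by
  cases τ with
  | null => exact h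
  | left => exact Finset.mem_map_of_mem π.toEmbedding h
  | right => exact congr_arg (Finset.map π.toEmbedding) h
  | full =>
    exact h.imp (Finset.mem_map_of_mem π.toEmbedding) (congr_arg (Finset.map π.toEmbedding))
  | unrestrained => exact h.imp (Finset.mem_map_of_mem π.toEmbedding) Finset.map_subset_map.2

theorem insertionCondition_image {X Y : Finset Atom} {A : Set (Atom × Finset Atom)}
    {τ : ControlType} (h : ∀ θ ∈ A, InsertionCondition X Y θ τ) (π : Equiv.Perm Atom) :
    ∀ θ ∈ renamePair π '' A,
      InsertionCondition (X.map π.toEmbedding) (Y.map π.toEmbedding) θ τ := by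
  rintro _ ⟨θ, hθ, rfl⟩
  exact (h θ hθ).rename π

theorem Unrestrained.rename {q : ℕ} {A : Set (Atom × Finset Atom)} (h : Unrestrained q A)
    (π : Equiv.Perm Atom) : Unrestrained q (renamePair π '' A) := by
  intro z W hW hz
  obtain ⟨θ, hθ, h₁, h₂⟩ := h (π.symm z) (W.map π.symm.toEmbedding)
    (by simpa using hW) (by simpa using hz)
  refine ⟨renamePair π θ, ⟨θ, hθ, rfl⟩, fun h => h₁ ?_, fun h => h₂ ?_⟩
  · refine Finset.mem_map.2 ⟨π θ.1, h, ?_⟩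
    simp
  · obtain ⟨a, ha, e⟩ := Finset.mem_map.1 h
    rw [← e]
    simpa using ha

theorem image_reduction_subset (A : Set (Atom × Finset Atom)) (X Y : Finset Atom)
    (π : Equiv.Perm Atom) : renamePair π '' reduction A X Y ⊆
      reduction (renamePair π '' A) (X.map π.toEmbedding) (Y.map π.toEmbedding) := by
  rintro _ ⟨⟨a, C⟩, ⟨B, h₁, h₂, h₃⟩, rfl⟩
  refine ⟨B.map π.toEmbedding, ⟨(a, B), h₁, rfl⟩, ?_, ?_⟩
  · simpa [renamePair] using h₂
  · change C.map π.toEmbedding = _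
    rw [show C = B \ X from h₃]
    ext b
    simp

theorem GoodControl.rename {p : ℕ} {X Y : Finset Atom} {A : Set (Atom × Finset Atom)}
    {τ : ControlType} (h : GoodControl p X Y A τ) (π : Equiv.Perm Atom) :
    GoodControl p (X.map π.toEmbedding) (Y.map π.toEmbedding) (renamePair π '' A) τ := by
  have hic := insertionCondition_image h.insertionCondition π
  have hfst (hY : ∀ y ∈ Y, ∃ B, (y, B) ∈ A) :
      ∀ y ∈ Y.map π.toEmbedding, ∃ B, (y, B) ∈ renamePair π '' A := by
    intro y hy
    obtain ⟨x, hx, rfl⟩ := Finset.mem_map.1 hy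
    obtain ⟨B, hB⟩ := hY x hx
    exact ⟨_, (x, B), hB, rfl⟩
  have hsnd : (∃ a, (a, X) ∈ A) → ∃ a, (a, X.map π.toEmbedding) ∈ renamePair π '' A :=
    fun ⟨a, ha⟩ => ⟨π a, (a, X), ha, rfl⟩
  cases τ with
  | null =>
    change renamePair π '' A = ∅
    rw [show A = ∅ from h, Set.image_empty]
  | left =>
    exact ⟨h.1.image _, fun θ hθ => Or.inl (hic θ hθ), (Finset.card_map _).trans h.2.2.1, hic,
      hfst h.2.2.2.2⟩
  | right =>
    exact ⟨h.1.image _, controls_of_eq_right fun θ hθ => Or.inr (hic θ hθ),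
      (Finset.card_map _).trans h.2.2.1, hic, hsnd h.2.2.2.2⟩
  | full =>
    exact ⟨h.1.image _, controls_of_eq_right hic, (Finset.card_map _).trans h.2.2.1, hic,
      hfst h.2.2.2.2.1, hsnd h.2.2.2.2.2⟩
  | unrestrained =>
    refine ⟨h.1.image _, hic, (Finset.card_map _).trans_lt h.2.2.1, hfst h.2.2.2.1, ?_⟩
    rw [Finset.card_map]
    exact (h.2.2.2.2.rename π).mono (image_reduction_subset A X Y π)

/-- Renaming of the atoms in a control profile. -/
instance : MulAction (Equiv.Perm Atom) (ControlProfile S Atom) where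
  smul π χ := ⟨χ.type, fun t s => (χ.X t s).map π.toEmbedding,
    fun t s => (χ.Y t s).map π.toEmbedding⟩
  one_smul χ := by
    obtain ⟨τ, X, Y⟩ := χ
    change ControlProfile.mk _ _ _ = _
    congr 1 <;> funext t s <;> exact Finset.map_refl
  mul_smul π π' χ := by
    obtain ⟨τ, X, Y⟩ := χ
    change ControlProfile.mk _ _ _ = ControlProfile.mk _ _ _
    congr 1 <;> funext t s <;> 
      exact (Finset.map_map π'.toEmbedding π.toEmbedding _).symm

theorem ControlProfile.Bounded.smul {p : ℕ} {χ : ControlProfile S Atom} (h : χ.Bounded p)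
    (π : Equiv.Perm Atom) : (π • χ).Bounded p := fun t s =>
  ⟨(Finset.card_map _).trans_le (h t s).1, (Finset.card_map _).trans_le (h t s).2⟩

theorem ControlProfile.exists_support [Finite S] (χ : ControlProfile S Atom) :
    ∃ T : Finset Atom, ∀ π, Fixes T π → π • χ = χ := by
  have := Fintype.ofFinite S
  let T : Finset Atom := Finset.univ.biUnion fun x : S × S => χ.X x.1 x.2 ∪ χ.Y x.1 x.2
  have hT (t s : S) : χ.X t s ∪ χ.Y t s ⊆ T :=
    Finset.subset_biUnion_of_mem (fun x : S × S => χ.X x.1 x.2 ∪ χ.Y x.1 x.2)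
      (Finset.mem_univ (t, s))
  refine ⟨T, fun π hπ => ?_⟩
  obtain ⟨τ, X, Y⟩ := χ
  change ControlProfile.mk _ _ _ = _
  congr 1
  · funext t s
    exact map_eq_self_of_fixes (Finset.subset_union_left.trans (hT t s)) hπ
  · funext t s
    exact map_eq_self_of_fixes (Finset.subset_union_right.trans (hT t s)) hπ

theorem finite_controlType : Finite ControlType :=
  Finite.of_surjective (fun i : Fin 5 => match i with
    | 0 => ControlType.null | 1 => .left | 2 => .right | 3 => .full | 4 => .unrestrained) (by
    rintro (_ | _ | _ | _ | _)
    exacts [⟨0, rfl⟩, ⟨1, rfl⟩, ⟨2, rfl⟩, ⟨3, rfl⟩, ⟨4, rfl⟩])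

theorem ControlProfile.few_bounded [Finite S] [Infinite Atom] (p : ℕ) :
    Few (∅ : Finset Atom) {χ : ControlProfile S Atom | χ.Bounded p} := by
  have := finite_controlType
  obtain ⟨c, hc⟩ := exists_finset_code (Atom := Atom) p
  obtain ⟨d, hd⟩ := exists_finset_code (Atom := Atom) ((p + 1).choose 2)
  refine Few.mk
    (ι := S → S → ControlType × Fin (p + 1) × Fin ((p + 1).choose 2 + 1))
    (κ := (S × S × Fin p) ⊕ (S × S × Fin ((p + 1).choose 2)))
    (fun χ t s => (χ.type t s, ⟨min (χ.X t s).card p, by omega⟩,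
      ⟨min (χ.Y t s).card ((p + 1).choose 2), by omega⟩))
    (fun χ => Sum.elim (fun x => c (χ.X x.1 x.2.1) x.2.2) (fun x => d (χ.Y x.1 x.2.1) x.2.2))
    fun χ hχ χ' hχ' π _ hi hj => ?_
  have h (t s : S) := congr_fun (congr_fun hi t) s
  simp only [Prod.mk.injEq, Fin.mk.injEq] at h
  have hX (t s : S) : χ'.X t s = (χ.X t s).map π.toEmbedding := by
    refine hc _ _ _ (hχ t s).1 ?_ fun j => hj (Sum.inl (t, s, j))
    have := (h t s).2.1
    rwa [min_eq_left (hχ t s).1, min_eq_left (hχ' t s).1] at this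
  have hY (t s : S) : χ'.Y t s = (χ.Y t s).map π.toEmbedding := by
    refine hd _ _ _ (hχ t s).2 ?_ fun j => hj (Sum.inr (t, s, j))
    have := (h t s).2.2
    rwa [min_eq_left (hχ t s).2, min_eq_left (hχ' t s).2] at this
  obtain ⟨τ', X', Y'⟩ := χ'
  change _ = ControlProfile.mk _ _ _
  congr 1
  · funext t s
    exact (h t s).1.symm
  · funext t s
    exact hX t s
  · funext t s
    exact hY t s

instance [Finite S] [Infinite Atom] : OrbitFiniteAlphabet Atom (AltLetter S Atom k) where
  few := by
    obtain ⟨c, hc⟩ := exists_finset_code (Atom := Atom) k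
    let a₀ : Atom := Classical.arbitrary Atom
    refine Few.mk (ι := Bool × S × S) (κ := Unit ⊕ Fin k)
      (fun σ => match σ with
        | .point s _ t => (true, s, t)
        | .block s _ _ t => (false, s, t))
      (fun σ => match σ with
        | .point _ a _ => fun _ => a
        | .block _ B _ _ => Sum.elim (fun _ => a₀) (c B))
      fun σ _ σ' _ π _ hi hj => ?_
    rcases σ with ⟨s, a, t⟩ | ⟨s, B, hB, t⟩ <;> rcases σ' with ⟨s', a', t'⟩ | ⟨s', B', hB', t'⟩ <;>
      simp only [Prod.mk.injEq, reduceCtorEq, false_and, true_and] at hi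
    · obtain ⟨rfl, rfl⟩ := hi
      have : a' = π a := hj (Sum.inl ())
      rw [this]
      rfl
    · obtain ⟨rfl, rfl⟩ := hi
      have : B' = B.map π.toEmbedding :=
        hc B B' π hB.le (hB.trans hB'.symm) fun j => hj (Sum.inr j)
      subst this
      rfl
  supported σ := by
    rcases σ with ⟨s, a, t⟩ | ⟨s, B, hB, t⟩
    · refine ⟨{a}, fun π hπ => ?_⟩
      change AltLetter.point s (π a) t = _
      rw [hπ a (Finset.mem_singleton_self a)]
    · refine ⟨B, fun π hπ => ?_⟩
      change AltLetter.block s (B.map π.toEmbedding) _ t = _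
      congr 1
      exact map_eq_self_of_fixes subset_rfl hπ

end Rename

/-! ### Insertion and removal of remainders -/

section Decomposition

open scoped Classical

variable {S Atom : Type*} {k : ℕ}

/-- The word `w` is consistent with the control profile `χ`. -/
def Consistent (χ : ControlProfile S Atom) (w : List (AltLetter S Atom k)) : Prop :=
  ∀ t s, GoodControl (k + 1) (χ.X t s) (χ.Y t s) (inducedSet w t s) (χ.type t s)

/-- The altering sets with ends in `P` that are consistent with the control profile `χ`. -/
def profileWords (k : ℕ) (P : Set ((S × Atom) × (S × Atom))) (χ : ControlProfile S Atom) :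
    Set (List (AltLetter S Atom k)) :=
  {w | (∃ e ∈ P, Altering e.1 w e.2) ∧ Consistent χ w}

theorem profileWords_univ (χ : ControlProfile S Atom) :
    profileWords k Set.univ χ = profileLanguage k χ := by
  ext w
  simp only [profileWords, profileLanguage, Consistent, alteringSets, Set.mem_ofPred_eq,
    Set.mem_univ, true_and, Prod.exists]

theorem exists_insert_remainder {χ : ControlProfile S Atom} {c c' : S × Atom}
    {w ρ : List (AltLetter S Atom k)} (hw : Altering c w c') (hχ : Consistent χ w)
    (hρ : ρ ∈ remainders k χ) :
    ∃ w', Altering c w' c' ∧ Consistent χ w' ∧ parikh w' = parikh w + parikh ρ := by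
  obtain ⟨t, s, E, hE, f, d, τ, rfl, hτ, hf, hd, hi, hc⟩ := hρ
  obtain ⟨l, hl⟩ := hw.traced
  obtain ⟨l', hl'⟩ := hτ.traced
  have hA (t s : S) : ∀ θ ∈ inducedSet w t s, θ.1 ∉ θ.2 ∧ θ.2.card = k + 1 := fun θ hθ =>
    hl.valid _ ((hl.inducedSet_eq t s ▸ hθ : θ ∈ {θ | ((t, s), θ) ∈ l}))
  obtain ⟨a, C, haC, ha, hdC, hgood⟩ := (hχ t s).exists_insertion (hA t s) hd
    (by rw [Finset.card_insert_of_notMem hf, hE]) hi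
  rw [hl.inducedSet_eq] at haC
  obtain ⟨l₁, l₂, rfl⟩ := List.append_of_mem (show ((t, s), (a, C)) ∈ l from haC)
  obtain ⟨w₁, w₂, B, hB, b, rfl, h₁, h₂, rfl, hb⟩ := hl.split
  simp only [Finset.mem_insert, not_or] at ha hd hdC
  have h₃ := hl'.append hB h₂ hdC.1 hdC.2 hb
  have h₄ := h₁.append hE h₃ ha.1 ha.2 hf
  refine ⟨_, h₄.altering, fun t' s' => ?_, ?_⟩
  · have hweak := weakControl_iff.1 (hc t' s')
    rw [hl'.inducedSet_eq] at hweak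
    rw [h₄.inducedSet_eq]
    by_cases hts : (t', s') = (t, s)
    · obtain ⟨rfl, rfl⟩ := Prod.mk.injEq .. ▸ hts
      have hic := hgood.insertionCondition
      refine hgood.mono ?_ ?_
      · rw [hl.inducedSet_eq]
        rintro θ (⟨hθ, hne⟩ | rfl | rfl)
        · have hne' : θ ≠ (a, insert b B) := hne
          simp only [Set.mem_ofPred_eq, List.mem_append, List.mem_cons, Prod.mk.injEq, true_and,
            hne', false_or] at hθ ⊢
          tauto
        · simp
        · simp
      · intro θ hθ
        simp only [Set.mem_ofPred_eq, List.mem_append, List.mem_cons, Prod.mk.injEq,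
          true_and] at hθ
        have hold (h : ((t', s'), θ) ∈ l₁ ∨ ((t', s'), θ) ∈ l₂) :
            InsertionCondition (χ.X t' s') (χ.Y t' s') θ (χ.type t' s') := by
          refine (hχ t' s').insertionCondition θ ?_
          rw [hl.inducedSet_eq]
          simp only [Set.mem_ofPred_eq, List.mem_append, List.mem_cons]
          tauto
        rcases hθ with h | rfl | h | rfl | h
        · exact hold (Or.inl h)
        · exact hic _ (by simp)
        · exact hweak θ h
        · exact hic _ (by simp)
        · exact hold (Or.inr h)
    · have h := hχ t' s'
      have hic := h.insertionCondition
      refine h.mono ?_ ?_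
      · rw [hl.inducedSet_eq]
        intro θ hθ
        simp only [Set.mem_ofPred_eq, List.mem_append, List.mem_cons,
          Prod.mk.injEq (t', s'), hts, false_and, false_or] at hθ ⊢
        tauto
      · rw [hl.inducedSet_eq] at hic
        intro θ hθ
        simp only [Set.mem_ofPred_eq, List.mem_append, List.mem_cons,
          Prod.mk.injEq (t', s'), hts, false_and, false_or] at hθ hic
        rcases hθ with h | h | h
        · exact hic θ (Or.inl h)
        · exact hweak θ h
        · exact hic θ (Or.inr h)
  · simp only [parikh_append, parikh_cons]
    abel

theorem exists_remove_remainder {χ : ControlProfile S Atom} {c c' : S × Atom}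
    {w : List (AltLetter S Atom k)} {l₁ l₂ l₃ : List ((S × S) × (Atom × Finset Atom))} {t s : S}
    {θ θ' : Atom × Finset Atom}
    (hw : Traced c w c' (l₁ ++ ((t, s), θ) :: (l₂ ++ ((t, s), θ') :: l₃))) (hχ : Consistent χ w)
    (h₁ : θ.1 ∉ θ'.2) (h₂ : θ'.1 ∉ θ.2)
    (h₃ : InsertionCondition (χ.X t s) (χ.Y t s) (θ.1, θ'.2) (χ.type t s))
    (h₄ : InsertionCondition (χ.X t s) (χ.Y t s) (θ'.1, θ.2) (χ.type t s))
    (hgood : ∀ t' s', ∃ V ⊆ {x | ((t', s'), x) ∈ l₁ ∨ ((t', s'), x) ∈ l₃},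
      GoodControl (k + 1) (χ.X t' s') (χ.Y t' s') V (χ.type t' s')) :
    ∃ w' ρ, Altering c w' c' ∧ Consistent χ w' ∧ w'.length < w.length ∧ ρ ∈ remainders k χ ∧
      ρ.length = 2 * l₂.length + 2 ∧ parikh w = parikh w' + parikh ρ := by
  obtain ⟨a, C⟩ := θ
  obtain ⟨d, C'⟩ := θ'
  have hic (t' s' : S) (x : Atom × Finset Atom) (hx : ((t', s'), x) ∈
      l₁ ++ ((t, s), (a, C)) :: (l₂ ++ ((t, s), (d, C')) :: l₃)) :
      InsertionCondition (χ.X t' s') (χ.Y t' s') x (χ.type t' s') := by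
    refine (hχ t' s').insertionCondition x ?_
    rw [hw.inducedSet_eq]
    exact hx
  obtain ⟨w₁, w', E, hE, f, rfl, hw₁, hw', rfl, hf⟩ := hw.split
  obtain ⟨τ, w₂, B, hB, b, rfl, hτ, hw₂, rfl, hb⟩ := hw'.split
  have h₁' := h₁
  simp only [Finset.mem_insert, not_or] at h₁'
  have h₅ := hw₁.append hB hw₂ h₁'.1 h₁'.2 hb
  refine ⟨_, _ :: τ, h₅.altering, fun t' s' => ?_, ?_,
    ⟨t, s, E, hE, f, d, τ, rfl, hτ.altering, hf, h₂, h₄, fun t' s' => ?_⟩, ?_, ?_⟩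
  · obtain ⟨V, hV, hVg⟩ := hgood t' s'
    rw [h₅.inducedSet_eq]
    refine hVg.mono (fun x hx => ?_) fun x hx => ?_
    · have := hV hx
      simp only [Set.mem_ofPred_eq, List.mem_append, List.mem_cons] at this ⊢
      tauto
    · simp only [Set.mem_ofPred_eq, List.mem_append, List.mem_cons] at hx
      rcases hx with h | h | h
      · exact hic t' s' x (by simp [h])
      · simp only [Prod.mk.injEq] at h
        obtain ⟨⟨rfl, rfl⟩, rfl⟩ := h
        exact h₃
      · exact hic t' s' x (by simp [h])
  · simp only [List.length_append, List.length_cons]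
    omega
  · rw [weakControl_iff, hτ.inducedSet_eq]
    intro x hx
    have hx : ((t', s'), x) ∈ l₂ := hx
    exact hic t' s' x (by simp [hx])
  · rw [List.length_cons, hτ.length]
  · simp only [parikh_append, parikh_cons]
    abel

/-- A long list has a window of length `L` that can be cut out without losing any of the
elements of `V`. -/
theorem exists_window {β : Type*} (L n : ℕ) (V : Finset β) (l : List β) (hV : ∀ v ∈ V, v ∈ l)
    (hn : V.card ≤ n) (hl : (n + 1) * L ≤ l.length) :
    ∃ l₁ m l₃, l = l₁ ++ (m ++ l₃) ∧ m.length = L ∧ ∀ v ∈ V, v ∈ l₁ ∨ v ∈ l₃ := by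
  induction n generalizing V l with
  | zero =>
    rw [Nat.le_zero, Finset.card_eq_zero] at hn
    subst hn
    refine ⟨[], l.take L, l.drop L, by simp, ?_, by simp⟩
    rw [List.length_take, min_eq_left (by simpa using hl)]
  | succ n ih =>
    have hl' : (n + 1) * L + L ≤ l.length := by rwa [Nat.succ_mul] at hl
    by_cases h : ∀ v ∈ V, v ∈ l.drop L
    · refine ⟨[], l.take L, l.drop L, by simp, ?_, fun v hv => Or.inr (h v hv)⟩
      rw [List.length_take, min_eq_left (by omega)]
    · push Not at h
      obtain ⟨v, hv, hvl⟩ := h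
      have hsub : V.filter (· ∈ l.drop L) ⊆ V.erase v := fun x hx => by
        obtain ⟨h₁, h₂⟩ := Finset.mem_filter.1 hx
        exact Finset.mem_erase.2 ⟨fun e => hvl (e ▸ h₂), h₁⟩
      have hcard := Finset.card_le_card hsub
      rw [Finset.card_erase_of_mem hv] at hcard
      obtain ⟨l₁, m, l₃, he, hm, hV'⟩ := ih (V.filter (· ∈ l.drop L)) (l.drop L)
        (fun x hx => (Finset.mem_filter.1 hx).2) (by omega) (by rw [List.length_drop]; omega)
      refine ⟨l.take L ++ l₁, m, l₃, ?_, hm, fun x hx => ?_⟩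
      · rw [List.append_assoc, ← he, List.take_append_drop]
      · by_cases hxl : x ∈ l.drop L
        · exact (hV' x (Finset.mem_filter.2 ⟨hx, hxl⟩)).imp_left (List.mem_append_right _)
        · have := hV x hx
          rw [← List.take_append_drop L l, List.mem_append] at this
          exact Or.inl (List.mem_append_left _ (this.resolve_right hxl))

theorem exists_eq_append_of_lt {β : Type*} (l : List β) {i j : ℕ} (hij : i < j)
    (hj : j < l.length) : ∃ l₁ l₂ l₃, l = l₁ ++ l[i] :: (l₂ ++ l[j] :: l₃) := by
  refine ⟨l.take i, (l.drop (i + 1)).take (j - (i + 1)), l.drop (j + 1), ?_⟩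
  have h₁ : l.drop (i + 1) = (l.drop (i + 1)).take (j - (i + 1)) ++ l[j] :: l.drop (j + 1) := by
    conv_lhs => rw [← List.take_append_drop (j - (i + 1)) (l.drop (i + 1))]
    rw [List.drop_drop, Nat.add_sub_cancel' hij, List.drop_eq_getElem_cons hj]
  rw [← h₁, ← List.drop_eq_getElem_cons, List.take_append_drop]

/-- The number of witnesses needed for good control by sets of sizes bounded as in a control
profile. -/
def witnessBound (p : ℕ) : ℕ :=
  (p + 1).choose 2 + 1 + ((p + 1) + (p + 1) * p * (p + 1))

/-- A number of infixes with `m` states that guarantees two infixes with the same states and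
exchangeable first components. -/
def windowBound (p m : ℕ) : ℕ :=
  m * m * ((p + 1).choose 2 + (2 * p + 1)) + 1

/-- A remainder of bounded length can be removed from a long altering set: outside of the infixes
that witness good control there is a long window, and two infixes of the window that have the same
states and exchangeable first components delimit a remainder. -/
theorem exists_decomposition [Finite S] [Infinite Atom] {χ : ControlProfile S Atom}
    (hb : χ.Bounded (k + 1)) {c c' : S × Atom} {w : List (AltLetter S Atom k)}
    (hw : Altering c w c') (hχ : Consistent χ w)
    (hlen : 2 * ((Nat.card S * Nat.card S * witnessBound (k + 1) + 1) *
      windowBound (k + 1) (Nat.card S)) < w.length) :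
    ∃ w' ρ, Altering c w' c' ∧ Consistent χ w' ∧ w'.length < w.length ∧ ρ ∈ remainders k χ ∧
      ρ.length ≤ 2 * windowBound (k + 1) (Nat.card S) ∧ parikh w = parikh w' + parikh ρ := by
  have := Fintype.ofFinite S
  obtain ⟨l, hl⟩ := hw.traced
  have hfin (t s : S) : (inducedSet w t s).Finite := by
    rw [hl.inducedSet_eq]
    exact l.toFinset.finite_toSet.preimage (Prod.mk_right_injective (t, s)).injOn |>.subset
      fun θ hθ => by simpa using hθ
  have hcard (t s : S) : ∀ θ ∈ inducedSet w t s, θ.2.card = k + 1 := fun θ hθ =>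
    (hl.valid _ ((hl.inducedSet_eq t s ▸ hθ : θ ∈ {θ | ((t, s), θ) ∈ l}))).2
  choose V hVA hVc hVg using fun t s => (hχ t s).exists_finset (hfin t s) (hcard t s)
  let U : Finset ((S × S) × (Atom × Finset Atom)) :=
    Finset.univ.biUnion fun x : S × S => (V x.1 x.2).image (Prod.mk x)
  have hUl : ∀ x ∈ U, x ∈ l := by
    intro x hx
    obtain ⟨⟨t, s⟩, -, hx⟩ := Finset.mem_biUnion.1 hx
    obtain ⟨θ, hθ, rfl⟩ := Finset.mem_image.1 hx
    have := hVA t s hθ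
    rw [hl.inducedSet_eq] at this
    exact this
  have hUc : U.card ≤ Nat.card S * Nat.card S * witnessBound (k + 1) := by
    refine (Finset.card_biUnion_le_card_mul _ _ (witnessBound (k + 1)) fun x _ => ?_).trans ?_
    · refine Finset.card_image_le.trans ((hVc x.1 x.2).trans ?_)
      have := (hb x.1 x.2).2
      unfold witnessBound
      omega
    · rw [Finset.card_univ, Fintype.card_prod, Nat.card_eq_fintype_card]
  rw [hl.length] at hlen
  obtain ⟨l₁, m, l₃, rfl, hm, hU⟩ := exists_window (windowBound (k + 1) (Nat.card S)) _ U l hUl hUc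
    (by omega)
  -- Many positions of the window have the same states.
  obtain ⟨⟨t, s⟩, -, hI⟩ := Finset.exists_lt_card_fiber_of_mul_lt_card_of_maps_to
    (s := (Finset.univ : Finset (Fin m.length))) (t := (Finset.univ : Finset (S × S)))
    (f := fun i => (m.get i).1) (n := (k + 1 + 1).choose 2 + (2 * (k + 1) + 1))
    (fun _ _ => Finset.mem_univ _) (by
      rw [Finset.card_univ, Finset.card_univ, Fintype.card_prod, Fintype.card_fin, hm,
        windowBound, Nat.card_eq_fintype_card]
      exact Nat.lt_succ_self _)
  have hmem (i : Fin m.length) : m.get i ∈ l₁ ++ (m ++ l₃) :=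
    List.mem_append_right _ (List.mem_append_left _ (List.get_mem m i))
  obtain ⟨i, hi, j, hj, hij, h⟩ := exists_exchange (p := k + 1) (X := χ.X t s) (Y := χ.Y t s)
    (τ := χ.type t s) (Finset.univ.filter fun i => (m.get i).1 = (t, s)) (fun i => (m.get i).2)
    (fun i _ => hl.valid _ (hmem i)) (fun i hi => by
      refine (hχ t s).insertionCondition _ ?_
      rw [hl.inducedSet_eq]
      have := hmem i
      rwa [← Prod.mk.eta (p := m.get i), (Finset.mem_filter.1 hi).2] at this)
    (by have := (hb t s).2; omega)
  replace hi := (Finset.mem_filter.1 hi).2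
  replace hj := (Finset.mem_filter.1 hj).2
  wlog hlt : i < j generalizing i j
  · exact this j i hij.symm ⟨h.2.1, h.1, h.2.2.2, h.2.2.1⟩ hj hi
      (lt_of_le_of_ne (not_lt.1 hlt) hij.symm)
  obtain ⟨m₁, m₂, m₃, e⟩ := exists_eq_append_of_lt m hlt j.2
  have hi' : m[i.1] = ((t, s), (m.get i).2) := Prod.ext hi rfl
  have hj' : m[j.1] = ((t, s), (m.get j).2) := Prod.ext hj rfl
  rw [hi', hj'] at e
  have e' : l₁ ++ (m ++ l₃) = (l₁ ++ m₁) ++ ((t, s), (m.get i).2) ::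
      (m₂ ++ ((t, s), (m.get j).2) :: (m₃ ++ l₃)) := by
    conv_lhs => rw [e]
    simp
  rw [e'] at hl
  obtain ⟨w', ρ, h₁, h₂, h₃, h₄, h₅, h₆⟩ := exists_remove_remainder hl hχ h.1 h.2.1 h.2.2.1 h.2.2.2
    fun t' s' => ⟨V t' s', fun x hx => by
      have : ((t', s'), x) ∈ U := Finset.mem_biUnion.2 ⟨(t', s'), Finset.mem_univ _,
        Finset.mem_image_of_mem _ hx⟩
      have := hU _ this
      simp only [Set.mem_ofPred_eq, List.mem_append]
      tauto, hVg t' s'⟩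
  refine ⟨w', ρ, h₁, h₂, h₃, h₄, ?_, h₆⟩
  have := congr_arg List.length e
  simp only [List.length_append, List.length_cons] at this
  omega

/-- The decomposition of the altering sets consistent with a control profile. -/
theorem parikhImage_profileWords [Finite S] [Infinite Atom] (P : Set ((S × Atom) × (S × Atom)))
    {χ : ControlProfile S Atom} (hb : χ.Bounded (k + 1)) :
    parikhImage (profileWords k P χ) = parikhImage (boundedLength (profileWords k P χ)
      (2 * ((Nat.card S * Nat.card S * witnessBound (k + 1) + 1) *
        windowBound (k + 1) (Nat.card S)))) +
      kleeneStar (parikhImage (boundedLength (remainders k χ)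
        (2 * windowBound (k + 1) (Nat.card S)))) := by
  apply Set.Subset.antisymm
  · rintro _ ⟨w, hw, rfl⟩
    induction hn : w.length using Nat.strong_induction_on generalizing w with
    | _ n ih =>
      obtain ⟨⟨e, he, hw'⟩, hχ⟩ := hw
      by_cases hlen : w.length ≤ 2 * ((Nat.card S * Nat.card S * witnessBound (k + 1) + 1) *
          windowBound (k + 1) (Nat.card S))
      · exact Set.mem_add.2 ⟨parikh w, ⟨w, ⟨⟨⟨e, he, hw'⟩, hχ⟩, hlen⟩, rfl⟩, 0, ⟨[], by simp, rfl⟩,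
          add_zero _⟩
      · obtain ⟨w', ρ, h₁, h₂, h₃, h₄, h₅, h₆⟩ := exists_decomposition hb hw' hχ (not_le.1 hlen)
        obtain ⟨x, hx, y, hy, hxy⟩ := Set.mem_add.1 (ih _ (hn ▸ h₃) w' ⟨⟨e, he, h₁⟩, h₂⟩ rfl)
        refine Set.mem_add.2 ⟨x, hx, parikh ρ + y, mem_kleeneStar_cons ⟨ρ, ⟨h₄, h₅⟩, rfl⟩ hy, ?_⟩
        rw [h₆, ← hxy]
        abel
  · rintro _ ⟨_, ⟨w, ⟨hw, -⟩, rfl⟩, _, ⟨l, hl, rfl⟩, rfl⟩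
    induction l generalizing w with
    | nil => exact ⟨w, hw, (add_zero _).symm⟩
    | cons x l ih =>
      obtain ⟨ρ, ⟨hρ, -⟩, rfl⟩ := hl x List.mem_cons_self
      obtain ⟨⟨e, he, hw⟩, hχ⟩ := hw
      obtain ⟨w', h₁, h₂, h₃⟩ := exists_insert_remainder hw hχ hρ
      have := ih w' ⟨⟨e, he, h₁⟩, h₂⟩ fun y hy => hl y (List.mem_cons_of_mem _ hy)
      change parikh w' + l.sum ∈ _ at this
      rwa [h₃, add_assoc, ← List.sum_cons] at this

/-! ### Semi-linearity of the altering sets -/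

theorem smul_mem_profileWords {P : Set ((S × Atom) × (S × Atom))} {π : Equiv.Perm Atom}
    (hP : ∀ e ∈ P, ((e.1.1, π e.1.2), (e.2.1, π e.2.2)) ∈ P) {χ : ControlProfile S Atom}
    {w : List (AltLetter S Atom k)} (hw : w ∈ profileWords k P χ) :
    w.map (π • ·) ∈ profileWords k P (π • χ) := by
  obtain ⟨⟨e, he, hw⟩, hχ⟩ := hw
  refine ⟨⟨_, hP e he, hw.map π⟩, fun t s => ?_⟩
  rw [hw.inducedSet_map]
  exact (hχ t s).rename π

theorem smul_mem_remainders (π : Equiv.Perm Atom) {χ : ControlProfile S Atom}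
    {ρ : List (AltLetter S Atom k)} (hρ : ρ ∈ remainders k χ) :
    ρ.map (π • ·) ∈ remainders k (π • χ) := by
  obtain ⟨t, s, E, hE, f, d, τ, rfl, hτ, hf, hd, hi, hc⟩ := hρ
  have e : insert (π f) (E.map π.toEmbedding) = (insert f E).map π.toEmbedding := by
    rw [Finset.map_insert]
    rfl
  refine ⟨t, s, E.map π.toEmbedding, (Finset.card_map _).trans hE, π f, π d, τ.map (π • ·), rfl,
    hτ.map π, by simpa using hf, by simpa using hd, ?_, fun t' s' => ?_⟩
  · rw [e]
    exact hi.rename π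
  · rw [weakControl_iff, hτ.inducedSet_map]
    exact insertionCondition_image (weakControl_iff.1 (hc t' s')) π

theorem supports_parikhImage_boundedLength {Γ : Type*} [MulAction (Equiv.Perm Atom) Γ]
    {T : Finset Atom} {L : Set (List Γ)}
    (hL : ∀ π : Equiv.Perm Atom, Fixes T π → ∀ w ∈ L, w.map (π • ·) ∈ L) (N : ℕ) :
    Supports T (parikhImage (boundedLength L N)) := by
  rintro π hπ _ ⟨w, ⟨hw, hN⟩, rfl⟩
  exact ⟨_, ⟨hL π hπ w hw, by simpa using hN⟩, (smul_parikh π w).symm⟩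

/-- The set of pairs of ends `P` is invariant under the permutations that fix `T`. -/
def SupportsEnds (T : Finset Atom) (P : Set ((S × Atom) × (S × Atom))) : Prop :=
  ∀ π, Fixes T π → ∀ e ∈ P, ((e.1.1, π e.1.2), (e.2.1, π e.2.2)) ∈ P

theorem semiLinear_profileWords [Finite S] [Infinite Atom] {T : Finset Atom}
    {P : Set ((S × Atom) × (S × Atom))} (hP : SupportsEnds T P) {χ : ControlProfile S Atom}
    (hb : χ.Bounded (k + 1)) : SemiLinear Atom (parikhImage (profileWords k P χ)) := by
  obtain ⟨T', hT'⟩ := χ.exists_support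
  have hbd {L : Set (List (AltLetter S Atom k))} (N : ℕ)
      (hL : ∀ π : Equiv.Perm Atom, Fixes (T ∪ T') π → ∀ w ∈ L, w.map (π • ·) ∈ L) (n : ℕ) :
      StarHeightLE Atom n (parikhImage (boundedLength L N)) := by
    refine .of_bounded (supports_parikhImage_boundedLength hL N) N ?_ n
    rintro _ ⟨w, hw, rfl⟩
    exact ⟨w, hw.2, rfl⟩
  rw [parikhImage_profileWords P hb]
  refine .add (hbd _ (fun π hπ w hw => ?_) 1) (.star (hbd _ (fun π hπ w hw => ?_) 0))
  · have := smul_mem_profileWords (hP π (hπ.mono Finset.subset_union_left)) hw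
    rwa [hT' π (hπ.mono Finset.subset_union_right)] at this
  · have := smul_mem_remainders π hw
    rwa [hT' π (hπ.mono Finset.subset_union_right)] at this

/-- Altering sets with ends in `P` have a semi-linear Parikh image, since each of them is consistent
with one of orbit-finitely many control profiles. -/
theorem semiLinear_altering [Finite S] [Infinite Atom] {T : Finset Atom}
    {P : Set ((S × Atom) × (S × Atom))} (hP : SupportsEnds T P) :
    SemiLinear Atom (parikhImage
      {w : List (AltLetter S Atom k) | ∃ e ∈ P, Altering e.1 w e.2}) := by
  have h : parikhImage {w : List (AltLetter S Atom k) | ∃ e ∈ P, Altering e.1 w e.2} =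
      ⋃ χ ∈ {χ : ControlProfile S Atom | χ.Bounded (k + 1)},
        parikhImage (profileWords k P χ) := by
    apply Set.Subset.antisymm
    · rintro _ ⟨w, ⟨e, he, hw⟩, rfl⟩
      obtain ⟨l, hl⟩ := hw.traced
      have hcard (t s : S) : ∀ θ ∈ inducedSet w t s, θ.2.card = k + 1 := fun θ hθ =>
        (hl.valid _ ((hl.inducedSet_eq t s ▸ hθ : θ ∈ {θ | ((t, s), θ) ∈ l}))).2
      choose τ X Y hX hY hg using fun t s => exists_goodControl (hcard t s)
      exact Set.mem_biUnion (x := ⟨τ, X, Y⟩) (fun t s => ⟨hX t s, hY t s⟩)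
        ⟨w, ⟨⟨e, he, hw⟩, show Consistent ⟨τ, X, Y⟩ w from hg⟩, rfl⟩
    · rintro v hv
      obtain ⟨χ, -, w, hw, rfl⟩ := Set.mem_iUnion₂.1 hv
      exact ⟨w, hw.1, rfl⟩
  rw [h]
  refine StarHeightLE.biUnion (T := T) ((ControlProfile.few_bounded _).mono (Finset.empty_subset T))
    (fun π _ χ hχ => hχ.smul π) ?_ fun χ hχ => semiLinear_profileWords hP hχ
  rintro π hπ χ _ ⟨w, hw, rfl⟩
  exact ⟨_, smul_mem_profileWords (hP π hπ) hw, (smul_parikh π w).symm⟩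

theorem semiLinear_alteringSets [Finite S] [Infinite Atom] :
    SemiLinear Atom (parikhImage (alteringSets S Atom k)) := by
  have h : alteringSets S Atom k =
      {w | ∃ e ∈ (Set.univ : Set ((S × Atom) × (S × Atom))), Altering e.1 w e.2} := by
    ext w
    simp only [alteringSets, Set.mem_ofPred_eq, Set.mem_univ, true_and, Prod.exists]
  rw [h]
  exact semiLinear_altering (T := ∅) fun _ _ _ _ => Set.mem_univ _

theorem semiLinear_alteringBetween [Finite S] [Infinite Atom] (c c' : S × Atom) :
    SemiLinear Atom (parikhImage (alteringBetween k c c')) := by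
  have h : alteringBetween k c c' =
      {w | ∃ e ∈ ({(c, c')} : Set ((S × Atom) × (S × Atom))), Altering e.1 w e.2} := by
    ext w
    simp [alteringBetween]
  rw [h]
  refine semiLinear_altering (T := {c.2, c'.2}) fun π hπ e he => ?_
  rw [Set.mem_singleton_iff.1 he]
  simp [hπ c.2 (by simp), hπ c'.2 (by simp)]

end Decomposition

/-! ### Walks in a finite graph -/

section Walk

variable {S Atom Γ : Type*}

/-- `Walk f s v t`: there is a walk from `s` to `t` in the complete graph on `S`, and `v` is a sum
of data vectors chosen from the sets `f s₁ s₂` for the traversed edges `(s₁, s₂)`. -/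
inductive Walk (f : S → S → Set (Γ →₀ ℕ)) : S → (Γ →₀ ℕ) → S → Prop
  | nil (s : S) : Walk f s 0 s
  | cons {s s' t : S} {v v' : Γ →₀ ℕ} : v ∈ f s s' → Walk f s' v' t → Walk f s (v + v') t

/-- The substitution that turns a `0`-altering set, read as a sequence of edges, into a sum of data
vectors along a walk; the atoms are ignored. -/
def walkLetter (f : S → S → Set (Γ →₀ ℕ)) : AltLetter S Atom 0 → Set (Γ →₀ ℕ)
  | .point s _ t => f s t
  | .block t _ _ s => {v | v = 0 ∧ t = s}

theorem Altering.walk {f : S → S → Set (Γ →₀ ℕ)} {c c' : S × Atom}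
    {w : List (AltLetter S Atom 0)} (h : Altering c w c') {v : Γ →₀ ℕ}
    (hv : v ∈ (w.map (walkLetter f)).sum) : Walk f c.1 v c'.1 := by
  induction h generalizing v with
  | single s a t =>
    have hv : v ∈ f s t := by simpa [walkLetter] using hv
    rw [← add_zero v]
    exact .cons hv (.nil t)
  | cons _ _ _ _ ih =>
    rw [List.map_cons, List.map_cons, List.sum_cons, List.sum_cons] at hv
    obtain ⟨x, hx, _, ⟨_, ⟨rfl, rfl⟩, y, hy, rfl⟩, rfl⟩ := hv
    refine .cons hx ?_
    change Walk f _ (0 + y) _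
    rw [zero_add]
    exact ih hy

/-- Two alternating atoms suffice to spell a non-empty walk as a `0`-altering set. -/
theorem Walk.exists_altering {f : S → S → Set (Γ →₀ ℕ)} {x y : Atom} (hxy : x ≠ y) {s s' t : S}
    {v v' : Γ →₀ ℕ} (hv : v ∈ f s s') (h : Walk f s' v' t) :
    ∃ w : List (AltLetter S Atom 0), (Altering (s, x) w (t, x) ∨ Altering (s, x) w (t, y)) ∧
      v + v' ∈ (w.map (walkLetter f)).sum := by
  induction h generalizing s v x y with
  | nil s' =>
    exact ⟨[.point s x s'], Or.inl (.single s x s'), by simpa [walkLetter] using hv⟩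
  | @cons s₁ s₂ t v₁ v₂ h₁ _ ih =>
    obtain ⟨w, hw, hvw⟩ := ih hxy.symm h₁
    refine ⟨.point s x s₁ :: .block s₁ ∅ rfl s₁ :: w, hw.symm.imp ?_ ?_, ?_⟩
    · exact .cons hxy (by simp) (by simp)
    · exact .cons hxy (by simp) (by simp)
    · rw [List.map_cons, List.map_cons, List.sum_cons, List.sum_cons]
      refine Set.add_mem_add hv ?_
      rw [← zero_add (v₁ + v₂)]
      exact Set.add_mem_add ⟨rfl, rfl⟩ hvw

/-- Parikh's theorem for finite graphs with rational sets attached to the edges. -/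
theorem StarHeightLE.walk [MulAction (Equiv.Perm Atom) Γ] [Finite S] [Infinite Atom]
    [OrbitFiniteAlphabet Atom Γ] {n : ℕ} {f : S → S → Set (Γ →₀ ℕ)}
    (hf : ∀ s t, StarHeightLE Atom n (f s t)) (s t : S) :
    StarHeightLE Atom (n + 1) {v | Walk f s v t} := by
  classical
  have := Fintype.ofFinite S
  obtain ⟨x, y, hxy⟩ := exists_pair_ne Atom
  choose T hT using fun s t => (hf s t).supported
  let T' : Finset Atom := Finset.univ.biUnion fun e : S × S => T e.1 e.2
  have hT' (s t : S) : Supports T' (f s t) :=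
    (hT s t).mono (Finset.subset_biUnion_of_mem (fun e : S × S => T e.1 e.2)
      (Finset.mem_univ (s, t)))
  have hg : SetEquivariant T' (walkLetter (Atom := Atom) f) := by
    rintro π hπ (⟨s, a, t⟩ | ⟨t, B, hB, s⟩) v hv
    · exact hT' s t π hπ v hv
    · obtain ⟨rfl, rfl⟩ := hv
      exact ⟨smul_vec_zero π, rfl⟩
  have hg' (σ : AltLetter S Atom 0) : StarHeightLE Atom n (walkLetter f σ) := by
    rcases σ with ⟨s, a, t⟩ | ⟨t, B, hB, s⟩
    · exact hf s t
    · by_cases h : t = s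
      · simpa [walkLetter, h] using StarHeightLE.zero n
      · simpa [walkLetter, h] using StarHeightLE.empty n
  have h (y : Atom) := ((semiLinear_alteringBetween (k := 0) (s, x) (t, y)).substitute hg hg').mono
    (Nat.add_comm 1 n).le
  have h0 : StarHeightLE Atom (n + 1) {v : Γ →₀ ℕ | v = 0 ∧ s = t} := by
    by_cases h : s = t
    · simpa [h] using StarHeightLE.zero (n + 1)
    · simpa [h] using StarHeightLE.empty (n + 1)
  have he : {v | Walk f s v t} = {v : Γ →₀ ℕ | v = 0 ∧ s = t} ∪
      (BlockParikh.substitute (walkLetter f) (parikhImage (alteringBetween 0 (s, x) (t, x))) ∪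
        BlockParikh.substitute (walkLetter f) (parikhImage (alteringBetween 0 (s, x) (t, y)))) := by
    rw [substitute_parikhImage, substitute_parikhImage]
    ext v
    constructor
    · rintro (_ | ⟨hv, hw⟩)
      · exact Or.inl ⟨rfl, rfl⟩
      · obtain ⟨w, hw | hw, hvw⟩ := Walk.exists_altering hxy hv hw
        · exact Or.inr (Or.inl (Set.mem_biUnion hw hvw))
        · exact Or.inr (Or.inr (Set.mem_biUnion hw hvw))
    · rintro (⟨rfl, rfl⟩ | hv | hv)
      · exact .nil s
      · obtain ⟨w, hw, hv⟩ := Set.mem_iUnion₂.1 hv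
        exact Altering.walk hw hv
      · obtain ⟨w, hw, hv⟩ := Set.mem_iUnion₂.1 hv
        exact Altering.walk hw hv
  rw [he]
  exact h0.union ((h x).union (h y))

end Walk

/-! ### One-register block automata -/

section BlockAutomata

open scoped Classical

variable {S H Atom : Type*} {k : ℕ}

instance [Finite H] : OrbitFiniteAlphabet Atom (Letter H Atom) where
  few := Few.mk (ι := H) (κ := Unit) Letter.label (fun σ _ => σ.atom)
    fun σ _ σ' _ π _ hi hj => by
      obtain ⟨h, a⟩ := σ
      obtain ⟨h', a'⟩ := σ'
      obtain rfl : h = h' := hi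
      obtain rfl : a' = π a := hj ()
      rfl
  supported σ := ⟨{σ.atom}, fun π hπ => by
    change Letter.mk σ.label (π σ.atom) = σ
    rw [hπ σ.atom (Finset.mem_singleton_self _)]⟩

/-- The assignment of the atom `a` to a single register. -/
def register (a : Atom) : Fin 1 ↪ Atom := ⟨fun _ => a, fun _ _ _ => Subsingleton.elim _ _⟩

theorem register_apply_zero (x : Fin 1 ↪ Atom) : register (x 0) = x := by
  ext i
  rw [Subsingleton.elim i 0]
  rfl

theorem Constraint.holds_congr {T : Type*} {ν ν' : T → Atom} (h : ∀ u v, ν u = ν v ↔ ν' u = ν' v)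
    (φ : Constraint T) : φ.Holds ν ↔ φ.Holds ν' := by
  induction φ with
  | top => exact Iff.rfl
  | eq u v => exact h u v
  | neg φ ih => exact not_congr ih
  | and φ ψ ih ih' => exact and_congr ih ih'
  | or φ ψ ih ih' => exact or_congr ih ih'

theorem Constraint.Holds.rename {r p : ℕ} {D : Finset Atom} {φ : Constraint (Term Atom r p D)}
    {x x' : Fin r → Atom} {b : Fin p → Atom} (h : φ.Holds (Term.val x b x'))
    {π : Equiv.Perm Atom} (hπ : Fixes D π) :
    φ.Holds (Term.val (fun i => π (x i)) (fun j => π (b j)) (fun i => π (x' i))) := by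
  have key (u : Term Atom r p D) :
      Term.val (fun i => π (x i)) (fun j => π (b j)) (fun i => π (x' i)) u =
        π (Term.val x b x' u) := by
    cases u with
    | cur i => rfl
    | inp j => rfl
    | next i => rfl
    | const d => exact (hπ d d.2).symm
  refine (φ.holds_congr fun u v => ?_).1 h
  rw [key, key, π.injective.eq_iff]

namespace BlockFMA

theorem Step.rename {M : BlockFMA 1 k S H Atom} {s s' : S} {a a' : Atom}
    {τ : List (Letter H Atom)} (h : M.Step (s, register a) τ (s', register a'))
    {π : Equiv.Perm Atom} (hπ : Fixes M.consts π) :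
    M.Step (s, register (π a)) (τ.map (π • ·)) (s', register (π a')) := by
  obtain ⟨ρ, hρ, h₁, h₂, b, hb, rfl⟩ := h
  exact ⟨ρ, hρ, h₁, h₂, fun j => π (b j), hb.rename hπ, by rw [List.map_ofFn]; rfl⟩

theorem Step.length_le {M : BlockFMA 1 k S H Atom} {c c' : Config 1 S Atom}
    {τ : List (Letter H Atom)} (h : M.Step c τ c') : τ.length ≤ k := by
  obtain ⟨ρ, hρ, -, -, b, -, rfl⟩ := h
  rw [List.length_ofFn]
  exact M.len_le ρ hρ

theorem Run.append {M : BlockFMA 1 k S H Atom} {c c' c'' : Config 1 S Atom}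
    {u u' : List (Letter H Atom)} (h : M.Run c u c') (h' : M.Run c' u' c'') :
    M.Run c (u ++ u') c'' := by
  induction h with
  | nil c => exact h'
  | cons h₁ _ ih =>
    rw [List.append_assoc]
    exact .cons h₁ (ih h')

/-- The Parikh vectors of the blocks read by steps from `s` to `s'` that keep the value `a` of the
register. -/
def stay (M : BlockFMA 1 k S H Atom) (a : Atom) (s s' : S) : Set (Letter H Atom →₀ ℕ) :=
  parikhImage {τ | M.Step (s, register a) τ (s', register a)}

theorem stay_rename (M : BlockFMA 1 k S H Atom) {a : Atom} {s s' : S} {v : Letter H Atom →₀ ℕ}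
    (hv : v ∈ M.stay a s s') {π : Equiv.Perm Atom} (hπ : Fixes M.consts π) :
    π • v ∈ M.stay (π a) s s' := by
  obtain ⟨τ, hτ, rfl⟩ := hv
  exact ⟨_, hτ.rename hπ, (smul_parikh π τ).symm⟩

theorem starHeightLE_stay [Finite H] (M : BlockFMA 1 k S H Atom) (a : Atom) (s s' : S) (n : ℕ) :
    StarHeightLE Atom n (M.stay a s s') := by
  refine .of_bounded (T := M.consts ∪ {a}) (fun π hπ v hv => ?_) k ?_ n
  · have := M.stay_rename hv (hπ.mono Finset.subset_union_left)
    rwa [hπ a (by simp)] at this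
  · rintro _ ⟨τ, hτ, rfl⟩
    exact ⟨τ, hτ.length_le, rfl⟩

theorem exists_run_of_walk {M : BlockFMA 1 k S H Atom} {a : Atom} {s t : S}
    {v : Letter H Atom →₀ ℕ} (h : Walk (M.stay a) s v t) :
    ∃ u, M.Run (s, register a) u (t, register a) ∧ v = parikh u := by
  induction h with
  | nil s => exact ⟨[], .nil _, rfl⟩
  | cons hv _ ih =>
    obtain ⟨τ, hτ, rfl⟩ := hv
    obtain ⟨u, hu, rfl⟩ := ih
    exact ⟨τ ++ u, .cons hτ hu, (parikh_append τ u).symm⟩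

theorem walk_rename {M : BlockFMA 1 k S H Atom} {a : Atom} {s t : S}
    {v : Letter H Atom →₀ ℕ} (h : Walk (M.stay a) s v t) {π : Equiv.Perm Atom}
    (hπ : Fixes M.consts π) : Walk (M.stay (π a)) s (π • v) t := by
  induction h with
  | nil s =>
    rw [smul_vec_zero]
    exact .nil s
  | cons hv _ ih =>
    rw [smul_vec_add]
    exact .cons (M.stay_rename hv hπ) ih

/-- The role of an input position in a step that changes the value of the register: the letter
carries the current value of the register, the next value, or another atom. -/
inductive Role
  | cur
  | next
  | other

instance : Finite Role :=
  Finite.of_surjective (fun i : Fin 3 => match i with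
    | 0 => Role.cur | 1 => .next | 2 => .other) (by
    rintro (_ | _ | _)
    exacts [⟨0, rfl⟩, ⟨1, rfl⟩, ⟨2, rfl⟩])

/-- The shapes of the steps that change the value of the register: a rule, the roles of its input
positions, and the constants that equal the current and the next value of the register. -/
abbrev Change (M : BlockFMA 1 k S H Atom) : Type _ :=
  Σ ρ : M.rules, (Fin ρ.1.len → Role) × (M.consts → Prop) × (M.consts → Prop)

instance (M : BlockFMA 1 k S H Atom) : Finite M.Change := by
  have := M.rules_finite.to_subtype
  infer_instance

/-- The constants that equal `a`. -/
def constPattern (M : BlockFMA 1 k S H Atom) (a : Atom) : M.consts → Prop := fun d => a = d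

theorem constPattern_rename (M : BlockFMA 1 k S H Atom) {π : Equiv.Perm Atom}
    (hπ : Fixes M.consts π) (a : Atom) : M.constPattern (π a) = M.constPattern a := by
  funext d
  unfold constPattern
  conv_lhs => rw [← hπ d d.2, π.injective.eq_iff]

variable {M : BlockFMA 1 k S H Atom}

/-- The contribution of the input positions of role `r` to the Parikh vector of a step. -/
noncomputable def Change.part (e : M.Change) (r : Role) (b : Fin e.1.1.len → Atom) :
    Letter H Atom →₀ ℕ :=
  parikh (((List.finRange e.1.1.len).filter fun j => e.2.1 j = r).map
    fun j => ⟨e.1.1.labels j, b j⟩)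

theorem Change.part_smul (e : M.Change) (r : Role) (b : Fin e.1.1.len → Atom)
    (π : Equiv.Perm Atom) : π • e.part r b = e.part r fun j => π (b j) := by
  rw [part, smul_parikh, List.map_map]
  rfl

theorem Change.part_congr (e : M.Change) {r : Role} {b b' : Fin e.1.1.len → Atom}
    (h : ∀ j, e.2.1 j = r → b j = b' j) : e.part r b = e.part r b' := by
  unfold part
  congr 1
  refine List.map_congr_left fun j hj => ?_
  rw [h j (by simpa using (List.mem_filter.1 hj).2)]

theorem Change.part_add (e : M.Change) (b : Fin e.1.1.len → Atom) :
    parikh (List.ofFn fun j => (⟨e.1.1.labels j, b j⟩ : Letter H Atom)) =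
      e.part .cur b + e.part .other b + e.part .next b := by
  rw [List.ofFn_eq_map]
  unfold part
  induction List.finRange e.1.1.len with
  | nil => rfl
  | cons j l ih =>
    rw [List.map_cons, parikh_cons, ih]
    rcases h : e.2.1 j <;> simp [h, parikh_cons] <;> abel

/-- The input atoms of a step, from the values of the register and the atoms at the positions of
role `other`. -/
def Change.fill (e : M.Change) (a : Atom) (b : Fin e.1.1.len → Atom) (a' : Atom) :
    Fin e.1.1.len → Atom := fun j =>
  match e.2.1 j with
  | .cur => a
  | .next => a'
  | .other => b j

/-- The contributions of the positions of role `other` with atoms from `B`, for a step of the given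
shape. The guard has to hold for all suitable values of the register outside of `B`; they are
interchangeable, so that it holds for all of them or for none. -/
def Change.others (e : M.Change) (B : Finset Atom) : Set (Letter H Atom →₀ ℕ) :=
  {v | ∃ b : Fin e.1.1.len → Atom, (∀ j, e.2.1 j = .other → b j ∈ B) ∧ v = e.part .other b ∧
    ∀ a a', a ≠ a' → a ∉ B → a' ∉ B → M.constPattern a = e.2.2.1 → M.constPattern a' = e.2.2.2 →
      e.1.1.guard.Holds (Term.val (register a) (e.fill a b a') (register a'))}

theorem Change.others_rename (e : M.Change) {B : Finset Atom} {v : Letter H Atom →₀ ℕ}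
    (hv : v ∈ e.others B) {π : Equiv.Perm Atom} (hπ : Fixes M.consts π) :
    π • v ∈ e.others (B.map π.toEmbedding) := by
  obtain ⟨b, hb, rfl, h⟩ := hv
  refine ⟨fun j => π (b j), fun j hj => Finset.mem_map_of_mem π.toEmbedding (hb j hj),
    e.part_smul .other b π, fun a a' haa ha ha' hp hp' => ?_⟩
  obtain ⟨a, rfl⟩ := π.surjective a
  obtain ⟨a', rfl⟩ := π.surjective a'
  rw [M.constPattern_rename hπ] at hp hp'
  have := (h a a' (fun h => haa (congr_arg π h)) (fun h => ha (Finset.mem_map_of_mem _ h))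
    (fun h => ha' (Finset.mem_map_of_mem _ h)) hp hp').rename hπ
  have hfill : (fun j => π (e.fill a b a' j)) = e.fill (π a) (fun j => π (b j)) (π a') := by
    funext j
    unfold fill
    cases e.2.1 j <;> rfl
  rwa [hfill] at this

theorem Change.starHeightLE_others [Finite H] (e : M.Change) (B : Finset Atom) (n : ℕ) :
    StarHeightLE Atom n (e.others B) := by
  refine .of_bounded (T := M.consts ∪ B) (fun π hπ v hv => ?_) e.1.1.len ?_ n
  · have := e.others_rename hv (hπ.mono Finset.subset_union_left)
    rwa [map_eq_self_of_fixes subset_rfl (hπ.mono Finset.subset_union_right)] at this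
  · rintro _ ⟨b, -, rfl, -⟩
    refine ⟨_, ?_, rfl⟩
    rw [List.length_map]
    exact (List.length_filter_le _ _).trans (List.length_finRange).le

/-- The state of the automaton after the change of the register, or at the start of a run. -/
def entry : S ⊕ M.Change → S
  | .inl s => s
  | .inr e => e.1.1.tgt

/-- The state of the automaton before the change of the register, or at the end of a run. -/
def exit : S ⊕ M.Change → S
  | .inl s => s
  | .inr e => e.1.1.src

/-- The letters with atom `a` read by the step that sets the register to `a`. -/
def entrySet : S ⊕ M.Change → Atom → Set (Letter H Atom →₀ ℕ)
  | .inl _, _ => {0}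
  | .inr e, a => {v | M.constPattern a = e.2.2.2 ∧ v = e.part .next fun _ => a}

/-- The letters with atom `a` read by the step that changes the value `a` of the register. -/
def exitSet : S ⊕ M.Change → Atom → Set (Letter H Atom →₀ ℕ)
  | .inl _, _ => {0}
  | .inr e, a => {v | M.constPattern a = e.2.2.1 ∧ v = e.part .cur fun _ => a}

/-- The substitution that recovers the runs of the automaton from altering sets. A letter
`⟨x, a, y⟩` stands for the part of a run with the value `a` in the register, together with the
letters with atom `a` read by the steps that start and end this part; a letter `⟨e, B, e⟩` stands
for the remaining letters read by a step that changes the register. -/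
noncomputable def expand (M : BlockFMA 1 k S H Atom) :
    AltLetter (S ⊕ M.Change) Atom k → Set (Letter H Atom →₀ ℕ)
  | .point x a y => entrySet x a + {v | Walk (M.stay a) (entry x) v (exit y)} + exitSet y a
  | .block (.inr e) B _ (.inr e') => {v | e = e' ∧ v ∈ e.others B}
  | .block _ _ _ _ => ∅

theorem entrySet_rename {x : S ⊕ M.Change} {a : Atom} {v : Letter H Atom →₀ ℕ}
    (hv : v ∈ entrySet x a) {π : Equiv.Perm Atom} (hπ : Fixes M.consts π) :
    π • v ∈ entrySet x (π a) := by
  rcases x with s | e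
  · obtain rfl := Set.mem_singleton_iff.1 hv
    exact smul_vec_zero π
  · obtain ⟨h, rfl⟩ := hv
    exact ⟨(M.constPattern_rename hπ a).trans h, e.part_smul _ _ π⟩

theorem exitSet_rename {x : S ⊕ M.Change} {a : Atom} {v : Letter H Atom →₀ ℕ}
    (hv : v ∈ exitSet x a) {π : Equiv.Perm Atom} (hπ : Fixes M.consts π) :
    π • v ∈ exitSet x (π a) := by
  rcases x with s | e
  · obtain rfl := Set.mem_singleton_iff.1 hv
    exact smul_vec_zero π
  · obtain ⟨h, rfl⟩ := hv
    exact ⟨(M.constPattern_rename hπ a).trans h, e.part_smul _ _ π⟩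

theorem setEquivariant_expand (M : BlockFMA 1 k S H Atom) :
    SetEquivariant M.consts M.expand := by
  rintro π hπ (⟨x, a, y⟩ | ⟨x | e, B, hB, y | e'⟩) v hv
  · obtain ⟨_, ⟨i, hi, r, hr, rfl⟩, o, ho, rfl⟩ := hv
    change π • (i + r + o) ∈ _
    rw [smul_vec_add, smul_vec_add]
    exact Set.add_mem_add (Set.add_mem_add (entrySet_rename hi hπ) (walk_rename hr hπ))
      (exitSet_rename ho hπ)
  · exact hv.elim
  · exact hv.elim
  · exact hv.elim
  · exact ⟨hv.1, e.others_rename hv.2 hπ⟩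

theorem starHeightLE_expand [Finite S] [Finite H] [Infinite Atom] (M : BlockFMA 1 k S H Atom)
    (σ : AltLetter (S ⊕ M.Change) Atom k) : StarHeightLE Atom 1 (M.expand σ) := by
  have hprop (p : Prop) (v₀ : Letter H Atom →₀ ℕ) :
      StarHeightLE Atom 1 {v | p ∧ v = v₀} := by
    by_cases hp : p
    · simpa [hp] using StarHeightLE.singleton (Atom := Atom) 1 v₀
    · simpa [hp] using StarHeightLE.empty 1
  rcases σ with ⟨x, a, y⟩ | ⟨x | e, B, hB, y | e'⟩
  · refine .add (.add ?_ (.walk (fun s t => M.starHeightLE_stay a s t 0) _ _)) ?_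
    · rcases x with s | e
      · exact .zero 1
      · exact hprop _ _
    · rcases y with s | e
      · exact .zero 1
      · exact hprop _ _
  · exact .empty 1
  · exact .empty 1
  · exact .empty 1
  · by_cases h : e = e'
    · simpa [expand, h] using e'.starHeightLE_others B 1
    · simpa [expand, h] using StarHeightLE.empty 1

theorem exists_run_of_altering {c c' : (S ⊕ M.Change) × Atom}
    {w : List (AltLetter (S ⊕ M.Change) Atom k)} (h : Altering c w c') {t : S} (ht : c'.1 = .inl t)
    {v : Letter H Atom →₀ ℕ} (hv : v ∈ (w.map M.expand).sum) :
    ∃ i ∈ entrySet c.1 c.2, ∃ u, M.Run (entry c.1, register c.2) u (t, register c'.2) ∧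
      v = i + parikh u := by
  induction h generalizing v with
  | single x a y =>
    obtain rfl : y = .inl t := ht
    have hv : v ∈ M.expand (.point x a (.inl t)) := by simpa using hv
    obtain ⟨_, ⟨i, hi, r, hr, rfl⟩, o, ho, rfl⟩ := hv
    obtain ⟨u, hu, rfl⟩ := exists_run_of_walk hr
    obtain rfl := Set.mem_singleton_iff.1 ho
    exact ⟨i, hi, u, hu, add_zero _⟩
  | @cons x a y B hB x' a' w c' haa ha ha' _ ih =>
    rw [List.map_cons, List.map_cons, List.sum_cons, List.sum_cons] at hv
    obtain ⟨_, ⟨_, ⟨i, hi, r, hr, rfl⟩, o, ho, rfl⟩, _, ⟨β, hβ, v', hv', rfl⟩, rfl⟩ := hv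
    obtain ⟨i', hi', u', hu', rfl⟩ := ih ht hv'
    obtain ⟨u, hu, rfl⟩ := exists_run_of_walk hr
    rcases y with _ | e <;> rcases x' with _ | e'
    · exact hβ.elim
    · exact hβ.elim
    · exact hβ.elim
    obtain ⟨rfl, b, hb, rfl, hg⟩ := hβ
    obtain ⟨hp, rfl⟩ := ho
    obtain ⟨hp', rfl⟩ := hi'
    have hstep : M.Step (exit (.inr e), register a)
        (List.ofFn fun j => ⟨e.1.1.labels j, e.fill a b a' j⟩) (entry (.inr e), register a') :=
      ⟨e.1.1, e.1.2, rfl, rfl, e.fill a b a', hg a a' haa ha ha' hp hp', rfl⟩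
    refine ⟨i, hi, _, hu.append (.cons hstep hu'), ?_⟩
    have h₁ : e.part .cur (e.fill a b a') = e.part .cur fun _ => a :=
      e.part_congr fun j hj => by simp [Change.fill, hj]
    have h₂ : e.part .next (e.fill a b a') = e.part .next fun _ => a' :=
      e.part_congr fun j hj => by simp [Change.fill, hj]
    have h₃ : e.part .other (e.fill a b a') = e.part .other b :=
      e.part_congr fun j hj => by simp [Change.fill, hj]
    rw [parikh_append, parikh_append, e.part_add, h₁, h₂, h₃]
    change i + parikh u + _ + (_ + (_ + parikh u')) = _
    abel

/-- A step that changes the register from `a` to `a'` decomposes according to some shape. -/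
theorem Step.exists_change [Infinite Atom] {s s' : S} {a a' : Atom} (haa : a ≠ a')
    {τ : List (Letter H Atom)} (h : M.Step (s, register a) τ (s', register a')) :
    ∃ (e : M.Change) (B : Finset Atom), B.card = k ∧ a ∉ B ∧ a' ∉ B ∧ e.1.1.src = s ∧
      e.1.1.tgt = s' ∧ ∃ o ∈ exitSet (.inr e) a, ∃ β ∈ e.others B, ∃ i ∈ entrySet (.inr e) a',
        parikh τ = o + β + i := by
  obtain ⟨ρ, hρ, h₁, h₂, b, hb, rfl⟩ := h
  let e : M.Change := ⟨⟨ρ, hρ⟩,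
    fun j => if b j = a then .cur else if b j = a' then .next else .other,
    M.constPattern a, M.constPattern a'⟩
  have hcur (j : Fin ρ.len) : e.2.1 j = .cur → b j = a := by
    simp only [e]
    split_ifs <;> simp_all
  have hnext (j : Fin ρ.len) : e.2.1 j = .next → b j = a' := by
    simp only [e]
    split_ifs <;> simp_all
  have hother (j : Fin ρ.len) : e.2.1 j = .other → b j ≠ a ∧ b j ≠ a' := by
    simp only [e]
    split_ifs <;> simp_all
  have hpair : ({a, a'} : Finset Atom).card = 2 := Finset.card_pair haa
  -- The input atoms other than `a` and `a'` are completed to a set of exactly `k` atoms.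
  obtain ⟨C, hC, hCc⟩ := Infinite.exists_superset_card_eq
    (Finset.univ.image b ∪ {a, a'}) (k + 2) (by
    have h₁ := Finset.card_union_le (Finset.univ.image b) {a, a'}
    have h₂ : (Finset.univ.image b).card ≤ ρ.len :=
      Finset.card_image_le.trans (Finset.card_fin _).le
    have h₃ := M.len_le ρ hρ
    omega)
  have hBc : (C \ {a, a'}).card = k := by
    rw [Finset.card_sdiff_of_subset (Finset.subset_union_right.trans hC), hCc, hpair]
    omega
  have hB (j : Fin ρ.len) (hj : e.2.1 j = .other) : b j ∈ C \ {a, a'} := by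
    have hbC : b j ∈ C :=
      hC (Finset.mem_union_left _ (Finset.mem_image_of_mem b (Finset.mem_univ j)))
    simpa [hbC] using hother j hj
  refine ⟨e, C \ {a, a'}, hBc, by simp, by simp, h₁, h₂, e.part .cur fun _ => a, ⟨rfl, rfl⟩,
    e.part .other b, ⟨b, hB, rfl, ?_⟩, e.part .next fun _ => a', ⟨rfl, rfl⟩, ?_⟩
  · intro x x' hxx hx hx' hp hp'
    have hc (d : M.consts) : (x = d ↔ a = d) ∧ (x' = d ↔ a' = d) :=
      ⟨iff_of_eq (congr_fun hp d), iff_of_eq (congr_fun hp' d)⟩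
    -- Some permutation fixes `B` and the constants and takes `(a, a')` to `(x, x')`.
    obtain ⟨π, hπ, hπx⟩ := exists_perm (M.consts ∪ (C \ {a, a'}))
      (fun i : Bool => cond i a a') (fun i => cond i x x')
      (by rintro (_ | _) (_ | _) <;> simp [haa, haa.symm, hxx, hxx.symm]) (by
        intro i d hd
        rcases Finset.mem_union.1 hd with hd | hd
        · cases i
          · exact (hc ⟨d, hd⟩).2.symm
          · exact (hc ⟨d, hd⟩).1.symm
        · have h₁ : a ≠ d := by rintro rfl; simp at hd
          have h₂ : a' ≠ d := by rintro rfl; simp at hd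
          have h₃ : x ≠ d := by rintro rfl; exact hx hd
          have h₄ : x' ≠ d := by rintro rfl; exact hx' hd
          cases i <;> simp [h₁, h₂, h₃, h₄])
    have hx : π a = x := hπx true
    have hx' : π a' = x' := hπx false
    have hg := hb.rename (hπ.mono Finset.subset_union_left)
    have hfill : (fun j => π (b j)) = e.fill x b x' := by
      funext j
      unfold Change.fill
      rcases h : e.2.1 j
      · exact (congr_arg π (hcur j h)).trans hx
      · exact (congr_arg π (hnext j h)).trans hx'
      · exact hπ _ (Finset.mem_union_right _ (hB j h))
    rw [hfill] at hg
    subst hx hx'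
    exact hg
  · rw [e.part_add, e.part_congr (r := .cur) fun j hj => hcur j hj,
      e.part_congr (r := .next) fun j hj => hnext j hj]

theorem Run.exists_altering [Infinite Atom] {c c' : Config 1 S Atom} {u : List (Letter H Atom)}
    (h : M.Run c u c') (x : S ⊕ M.Change) (hx : entry x = c.1) {i : Letter H Atom →₀ ℕ}
    (hi : i ∈ entrySet x (c.2 0)) :
    ∃ w : List (AltLetter (S ⊕ M.Change) Atom k),
      Altering (x, c.2 0) w (.inl c'.1, c'.2 0) ∧ i + parikh u ∈ (w.map M.expand).sum := by
  induction h generalizing x i with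
  | nil c =>
    refine ⟨[.point x (c.2 0) (.inl c.1)], .single _ _ _, ?_⟩
    rw [List.map_cons, List.map_nil, List.sum_cons, List.sum_nil, add_zero, parikh_nil,
      ← add_zero (i + 0)]
    refine Set.add_mem_add (Set.add_mem_add hi ?_) rfl
    rw [hx]
    exact .nil _
  | @cons c c₁ c' τ u hstep _ ih =>
    obtain ⟨s, r⟩ := c
    obtain ⟨s₁, r₁⟩ := c₁
    rw [← register_apply_zero r, ← register_apply_zero r₁] at hstep
    generalize r 0 = a at hstep hi ⊢
    generalize r₁ 0 = a₁ at hstep ih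
    by_cases haa : a = a₁
    · subst haa
      obtain ⟨w, hw, hv⟩ := ih (.inl s₁) rfl (i := 0) rfl
      -- The first letter of `w` absorbs the step.
      obtain ⟨y, w', rfl, hw'⟩ : ∃ y w', w = .point (.inl s₁) a y :: w' ∧
          Altering (x, a) (.point x a y :: w') (.inl c'.1, c'.2 0) := by
        generalize hd : ((.inl c'.1, c'.2 0) : (S ⊕ M.Change) × Atom) = d at hw
        cases hw with
        | single => exact ⟨_, _, rfl, .single _ _ _⟩
        | cons h₁ h₂ h₃ h₄ => exact ⟨_, _, rfl, .cons h₁ h₂ h₃ h₄⟩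
      refine ⟨_, hw', ?_⟩
      rw [List.map_cons, List.sum_cons] at hv ⊢
      obtain ⟨_, ⟨_, ⟨_, hz, q, hq, rfl⟩, o, ho, rfl⟩, v', hv', hv⟩ := hv
      obtain rfl := Set.mem_singleton_iff.1 hz
      change 0 + q + o + v' = 0 + parikh u at hv
      have hsum : i + parikh (τ ++ u) = i + (parikh τ + q) + o + v' := by
        rw [parikh_append, ← zero_add (parikh u), ← hv]
        abel
      rw [hsum]
      refine Set.add_mem_add (Set.add_mem_add (Set.add_mem_add hi ?_) ho) hv'
      rw [hx]
      exact .cons ⟨τ, hstep, rfl⟩ hq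
    · obtain ⟨e, B, hB, ha, ha₁, hs, hs₁, o, ho, β, hβ, i₁, hi₁, hτ⟩ := hstep.exists_change haa
      obtain ⟨w, hw, hv⟩ := ih (.inr e) hs₁ hi₁
      refine ⟨.point x a (.inr e) :: .block (.inr e) B hB (.inr e) :: w, .cons haa ha ha₁ hw, ?_⟩
      rw [List.map_cons, List.map_cons, List.sum_cons, List.sum_cons]
      have hsum : i + parikh (τ ++ u) = i + 0 + o + (β + (i₁ + parikh u)) := by
        rw [parikh_append, hτ]
        abel
      rw [hsum]
      refine Set.add_mem_add (Set.add_mem_add (Set.add_mem_add hi ?_) ho)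
        (Set.add_mem_add ⟨rfl, hβ⟩ hv)
      rw [hx, ← hs]
      exact .nil _

theorem starHeightLE_language [Finite S] [Finite H] [Infinite Atom] (M : BlockFMA 1 k S H Atom) :
    StarHeightLE Atom 2 (parikhImage M.language) := by
  let P : Set (((S ⊕ M.Change) × Atom) × ((S ⊕ M.Change) × Atom)) :=
    {e | e.1 = (.inl M.init, M.reg₀ 0) ∧ ∃ s ∈ M.accept, e.2.1 = .inl s}
  have hP : SupportsEnds {M.reg₀ 0} P := by
    rintro π hπ ⟨c, c'⟩ ⟨rfl, hc'⟩
    exact ⟨Prod.ext rfl (hπ _ (Finset.mem_singleton_self _)), hc'⟩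
  have h : parikhImage M.language = substitute M.expand
      (parikhImage {w : List (AltLetter (S ⊕ M.Change) Atom k) | ∃ e ∈ P, Altering e.1 w e.2}) := by
    rw [substitute_parikhImage]
    apply Set.Subset.antisymm
    · rintro _ ⟨u, ⟨s, hs, r, hu⟩, rfl⟩
      obtain ⟨w, hw, hv⟩ := hu.exists_altering (.inl M.init) rfl (i := 0) rfl
      rw [zero_add] at hv
      exact Set.mem_biUnion (x := w) ⟨(_, _), ⟨rfl, s, hs, rfl⟩, hw⟩ hv
    · intro v hv
      obtain ⟨w, ⟨⟨c, c'⟩, ⟨rfl, s, hs, hc'⟩, hw⟩, hv⟩ := Set.mem_iUnion₂.1 hv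
      obtain ⟨i, hi, u, hu, rfl⟩ := exists_run_of_altering hw hc' hv
      obtain rfl := Set.mem_singleton_iff.1 hi
      rw [register_apply_zero] at hu
      exact ⟨u, ⟨s, hs, _, hu⟩, (zero_add _).symm⟩
  rw [h]
  exact (semiLinear_altering hP).substitute M.setEquivariant_expand M.starHeightLE_expand

end BlockFMA

end BlockAutomata

/-! ### Expressiveness of block automata -/

section Separation

variable {H Atom : Type*}

/-- A finite-memory automaton, as a block automaton whose blocks are single letters. -/
def FMA.toBlock {r : ℕ} {S : Type*} (M : FMA r S H Atom) : BlockFMA r 1 S H Atom where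
  init := M.init
  accept := M.accept
  consts := M.consts
  reg₀ := M.reg₀
  rules := (fun ρ => ⟨ρ.src, 1, fun _ => ρ.label, ρ.guard, ρ.tgt⟩) '' M.rules
  rules_finite := M.rules_finite.image _
  len_le := by
    rintro _ ⟨ρ, -, rfl⟩
    exact le_rfl

theorem FMA.toBlock_step_iff {r : ℕ} {S : Type*} (M : FMA r S H Atom) {c c' : Config r S Atom}
    {τ : List (Letter H Atom)} : M.toBlock.Step c τ c' ↔ ∃ σ, τ = [σ] ∧ M.Step c σ c' := by
  constructor
  · rintro ⟨_, ⟨ρ, hρ, rfl⟩, h₁, h₂, b, hb, rfl⟩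
    refine ⟨⟨ρ.label, b 0⟩, rfl, ρ, hρ, h₁, h₂, rfl, ?_⟩
    have : (fun _ => b 0) = b := funext fun j => by rw [Subsingleton.elim j 0]
    change ρ.guard.Holds (Term.val c.2 (fun _ => b 0) c'.2)
    rwa [this]
  · rintro ⟨σ, rfl, ρ, hρ, h₁, h₂, h₃, h₄⟩
    refine ⟨_, ⟨ρ, hρ, rfl⟩, h₁, h₂, fun _ => σ.atom, h₄, ?_⟩
    obtain ⟨h, a⟩ := σ
    obtain rfl : ρ.label = h := h₃
    rfl

theorem FMA.toBlock_run_iff {r : ℕ} {S : Type*} (M : FMA r S H Atom) {c c' : Config r S Atom}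
    {w : List (Letter H Atom)} : M.toBlock.Run c w c' ↔ M.Run c w c' := by
  constructor
  · intro h
    induction h with
    | nil c => exact .nil c
    | cons h _ ih =>
      obtain ⟨σ, rfl, h'⟩ := M.toBlock_step_iff.1 h
      exact .cons h' ih
  · intro h
    induction h with
    | nil c => exact .nil c
    | cons h _ ih => exact .cons (M.toBlock_step_iff.2 ⟨_, rfl, h⟩) ih

theorem fmaLanguages_subset (r : ℕ) : fmaLanguages r H Atom ⊆ blockFMALanguages r H Atom := by
  rintro _ ⟨S, hS, M, rfl⟩
  refine ⟨1, one_pos, S, hS, M.toBlock, ?_⟩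
  ext w
  exact exists_congr fun s => and_congr_right fun _ => exists_congr fun a =>
    M.toBlock_run_iff.symm

theorem FMA.Step.rename {S : Type*} {M : FMA 1 S H Atom} {c c' : Config 1 S Atom}
    {σ : Letter H Atom} (h : M.Step c σ c') {π : Equiv.Perm Atom} (hπ : Fixes M.consts π) :
    M.Step (c.1, register (π (c.2 0))) (π • σ) (c'.1, register (π (c'.2 0))) := by
  obtain ⟨ρ, hρ, h₁, h₂, h₃, h₄⟩ := h
  refine ⟨ρ, hρ, h₁, h₂, h₃, ?_⟩
  rw [← register_apply_zero c.2, ← register_apply_zero c'.2] at h₄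
  exact h₄.rename hπ

theorem FMA.Run.rename {S : Type*} {M : FMA 1 S H Atom} {c c' : Config 1 S Atom}
    {w : List (Letter H Atom)} (h : M.Run c w c') {π : Equiv.Perm Atom} (hπ : Fixes M.consts π) :
    M.Run (c.1, register (π (c.2 0))) (w.map (π • ·)) (c'.1, register (π (c'.2 0))) := by
  induction h with
  | nil c => exact .nil _
  | cons h _ ih => exact .cons (h.rename hπ) ih

theorem FMA.Run.append {r : ℕ} {S : Type*} {M : FMA r S H Atom} {c c' c'' : Config r S Atom}
    {u u' : List (Letter H Atom)} (h : M.Run c u c') (h' : M.Run c' u' c'') :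
    M.Run c (u ++ u') c'' := by
  induction h with
  | nil c => exact h'
  | cons h₁ _ ih => exact .cons h₁ (ih h')

theorem FMA.Run.split {r : ℕ} {S : Type*} {M : FMA r S H Atom} {c c' : Config r S Atom}
    {u u' : List (Letter H Atom)} (h : M.Run c (u ++ u') c') :
    ∃ d, M.Run c u d ∧ M.Run d u' c' := by
  induction u generalizing c with
  | nil => exact ⟨c, .nil c, h⟩
  | cons σ u ih =>
    cases h with
    | cons h₁ h₂ =>
      obtain ⟨d, h₃, h₄⟩ := ih h₂
      exact ⟨d, .cons h₁ h₃, h₄⟩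

/-- The suffix of an accepted word may be renamed by a permutation that fixes the constants and the
value of the register before the suffix. -/
theorem FMA.exists_rename_suffix {S : Type*} {M : FMA 1 S H Atom} {u u' : List (Letter H Atom)}
    (h : u ++ u' ∈ M.language) : ∃ x : Atom, ∀ π : Equiv.Perm Atom, Fixes M.consts π → π x = x →
      u ++ u'.map (π • ·) ∈ M.language := by
  obtain ⟨s, hs, r, hr⟩ := h
  obtain ⟨d, h₁, h₂⟩ := hr.split
  refine ⟨d.2 0, fun π hπ hx => ⟨s, hs, register (π (r 0)), h₁.append ?_⟩⟩
  have := h₂.rename hπ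
  rwa [hx, register_apply_zero] at this

/-- The language of the words that repeat two letters, all with the label `h`. -/
def repeatLanguage (h : H) : Set (List (Letter H Atom)) :=
  {w | ∃ a b : Atom, w = [⟨h, a⟩, ⟨h, b⟩, ⟨h, a⟩, ⟨h, b⟩]}

/-- A block automaton reads a word that repeats two letters as a single block. -/
theorem repeatLanguage_mem_blockFMALanguages [Nonempty Atom] (h : H) :
    repeatLanguage h ∈ blockFMALanguages 1 H Atom := by
  let ρ : BlockRule 1 Bool H (∅ : Finset Atom) :=
    ⟨false, 4, fun _ => h, .and (.eq (.inp 0) (.inp 2)) (.eq (.inp 1) (.inp 3)), true⟩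
  let M : BlockFMA 1 4 Bool H Atom :=
    ⟨false, {true}, ∅, register (Classical.arbitrary Atom), {ρ}, Set.finite_singleton ρ,
      fun _ h => by rw [Set.mem_singleton_iff.1 h]⟩
  refine ⟨4, by norm_num, Bool, inferInstance, M, ?_⟩
  apply Set.Subset.antisymm
  · rintro _ ⟨a, b, rfl⟩
    refine ⟨true, rfl, M.reg₀, ?_⟩
    have hstep : M.Step (M.init, M.reg₀) [⟨h, a⟩, ⟨h, b⟩, ⟨h, a⟩, ⟨h, b⟩] (true, M.reg₀) :=
      ⟨ρ, rfl, rfl, rfl, ![a, b, a, b], ⟨rfl, rfl⟩, rfl⟩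
    exact .cons hstep (.nil _)
  · rintro w ⟨s, hs, r, hr⟩
    obtain rfl : s = true := hs
    generalize hc : (M.init, M.reg₀) = c at hr
    generalize hc' : (true, r) = c' at hr
    cases hr with
    | nil => simp [← hc', M] at hc
    | @cons _ c₁ _ τ w h₁ h₂ =>
      obtain ⟨_, rfl, h₃, h₄, b, ⟨hb, hb'⟩, rfl⟩ := h₁
      cases h₂ with
      | nil =>
        have h02 : b 0 = b 2 := hb
        have h13 : b 1 = b 3 := hb'
        refine ⟨b 0, b 1, ?_⟩
        rw [List.append_nil]
        change [_, _, Letter.mk h (b 2), Letter.mk h (b 3)] = _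
        rw [← h02, ← h13]
        rfl
      | cons h₅ _ =>
        obtain ⟨_, rfl, h₆, -⟩ := h₅
        exact absurd (h₆.trans h₄.symm) (by simp [ρ])

/-- After the first half of a word `abab` with distinct atoms `a` and `b`, a single register misses
one of the two, and this atom may be renamed in the second half. -/
theorem repeatLanguage_notMem_fmaLanguages [Infinite Atom] (h : H) :
    repeatLanguage h ∉ fmaLanguages 1 H Atom := by
  classical
  rintro ⟨S, -, M, hM⟩
  obtain ⟨a, ha⟩ := Infinite.exists_notMem_finset M.consts
  obtain ⟨b, hb⟩ := Infinite.exists_notMem_finset (insert a M.consts)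
  have hw : ([⟨h, a⟩, ⟨h, b⟩] ++ [⟨h, a⟩, ⟨h, b⟩] : List (Letter H Atom)) ∈ M.language := by
    rw [← hM]
    exact ⟨a, b, rfl⟩
  obtain ⟨x, hx⟩ := FMA.exists_rename_suffix hw
  obtain ⟨c, hc⟩ := Infinite.exists_notMem_finset (insert x (insert a (insert b M.consts)))
  simp only [Finset.mem_insert, not_or] at hb hc
  have key (d : Atom) (hd : d ∉ M.consts) (hdx : d ≠ x) : ∃ a' b' : Atom,
      ([⟨h, a⟩, ⟨h, b⟩, ⟨h, Equiv.swap d c a⟩, ⟨h, Equiv.swap d c b⟩] : List (Letter H Atom)) =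
        [⟨h, a'⟩, ⟨h, b'⟩, ⟨h, a'⟩, ⟨h, b'⟩] := by
    have := hx (Equiv.swap d c) (fun e he => Equiv.swap_apply_of_ne_of_ne
      (fun h => hd (h ▸ he)) (fun h => hc.2.2.2 (h ▸ he)))
      (Equiv.swap_apply_of_ne_of_ne hdx.symm (Ne.symm hc.1))
    rw [← hM] at this
    exact this
  by_cases hax : a = x
  · obtain ⟨a', b', h'⟩ := key b hb.2 (fun h => hb.1 (h.trans hax.symm))
    simp at h'
    obtain ⟨-, rfl, -, h'⟩ := h'
    exact hc.2.2.1 h'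
  · obtain ⟨a', b', h'⟩ := key a ha hax
    simp at h'
    obtain ⟨rfl, -, h', -⟩ := h'
    exact hc.2.1 h'

theorem fmaLanguages_ssubset [Nonempty H] [Infinite Atom] :
    fmaLanguages 1 H Atom ⊂ blockFMALanguages 1 H Atom := by
  obtain ⟨h⟩ := ‹Nonempty H›
  exact ⟨fmaLanguages_subset 1, fun hsub => repeatLanguage_notMem_fmaLanguages h
    (hsub (repeatLanguage_mem_blockFMALanguages h))⟩

end Separation

end BlockParikh

theorem mainTheorem2 (Atom : Type*) [Infinite Atom] :
    -- the star-height of the Parikh images of one-register block finite-memory automata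
    (∀ (H : Type*) [Finite H] (S : Type*) [Finite S] (k : ℕ)
      (M : BlockParikh.BlockFMA 1 k S H Atom),
      BlockParikh.StarHeightLE Atom 2 (BlockParikh.parikhImage M.language)) ∧
    -- they are strictly more expressive than one-register finite-memory automata
    (∀ (H : Type*) [Finite H] [Nonempty H],
      BlockParikh.fmaLanguages 1 H Atom ⊂ BlockParikh.blockFMALanguages 1 H Atom) ∧
    -- altering sets have semi-linear Parikh images, also with prescribed ends
    (∀ (S : Type*) [Finite S] (k : ℕ),
      BlockParikh.SemiLinear Atom
        (BlockParikh.parikhImage (BlockParikh.alteringSets S Atom k)) ∧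
      ∀ c c' : S × Atom, BlockParikh.SemiLinear Atom
        (BlockParikh.parikhImage (BlockParikh.alteringBetween k c c'))) ∧
    -- the decomposition for each control profile, with uniform bounds
    (∀ k m : ℕ, ∃ N₀ N₁ : ℕ, ∀ (S : Type*) [Finite S], Nat.card S = m →
      ∀ χ : BlockParikh.ControlProfile S Atom, χ.Bounded (k + 1) →
        BlockParikh.SemiLinear Atom
          (BlockParikh.parikhImage (BlockParikh.profileLanguage k χ)) ∧
        BlockParikh.parikhImage (BlockParikh.profileLanguage k χ) =
          BlockParikh.parikhImage
            (BlockParikh.boundedLength (BlockParikh.profileLanguage k χ) N₀) +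
          BlockParikh.kleeneStar (BlockParikh.parikhImage
            (BlockParikh.boundedLength (BlockParikh.remainders k χ) N₁))) := by
  refine ⟨fun H _ S _ k M => M.starHeightLE_language,
    fun H _ _ => BlockParikh.fmaLanguages_ssubset,
    fun S _ k => ⟨BlockParikh.semiLinear_alteringSets,
      fun c c' => BlockParikh.semiLinear_alteringBetween c c'⟩,
    fun k m => ⟨2 * ((m * m * BlockParikh.witnessBound (k + 1) + 1) *
      BlockParikh.windowBound (k + 1) m), 2 * BlockParikh.windowBound (k + 1) m, ?_⟩⟩
  rintro S _ rfl χ hχ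
  rw [← BlockParikh.profileWords_univ]
  exact ⟨BlockParikh.semiLinear_profileWords (T := ∅) (fun _ _ _ _ => Set.mem_univ _) hχ,
    BlockParikh.parikhImage_profileWords Set.univ hχ⟩
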